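/- Let $p,q$ be odd primes with $p\mid q-1$, let $n\in(\mathbb Z/q)^\times$ satisfy $n^p=1$, $n\neq 1$, and let $$G=\mathbb Z/q\rtimes\mathbb Z/p=\langle a,b\mid a^q=b^p=1,\ bab^{-1}=a^n\rangle .$$ Let $\omega$ be the 3-cocycle on $G$ inflated from $\langle b\rangle\cong\mathbb Z/p$ given by $\omega(b^i,b^j,b^k)=\exp\left(\frac{2\pi i}{p^2}[i]([j]+[k]-[j+k])\right)$, where $[i]\in\{0,\dots,p-1\}$ represents $i$ modulo $p$, and let $u\in\{0,\dots,p-1\}$. Let $\mathrm{Vect}_G^{\omega^u}$ be the category of finite-dimensional $G$-graded complex vector spaces with associativity constraint $(x\otimes y)\otimes z\mapsto\omega^u(|x|,|y|,|z|)\,x\otimes(y\otimes z)$, and let $\mathcal Z(\mathrm{Vect}_G^{\omega^u})$ be its (right) Drinfeld center, with half-braidings $\sigma_{V,W}\colon V\otimes W\to W\otimes V$, $v\otimes w\mapsto (|v|\triangleright w)\otimes v$, for $W$ in the center. For objects $X,Y,Z$ of the center put $B_{X,Y,Z}=\mathrm{tr}\left((\sigma_2^{-1}\sigma_1)^3\right)$,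 the (pivotal) trace of the endomorphism of $(X\otimes Y)\otimes Z$ defined by the braid $(\sigma_2^{-1}\sigma_1)^3$, whose closure is the borromean link. An object $X$ of the center is said to be of type $(g,\chi)$ if the degrees of its nonzero homogeneous components form the conjugacy class of $g$ and $\chi(c)$ is the trace of $c\triangleright-$ on the component $X_g$ for all $c$ in the centralizer $C_G(g)$. Let $l,s\in\mathbb Z/q$ with $l\ne0$, and $k,r\in\mathbb Z/p$ with $k\neq0$. Then there are objects of type $(a^l,\chi_q^s)$, where $\chi_q^s(a^j)=\exp(2\pi i\,sj/q)$ on $C_G(a^l)=\langle a\rangle$, and objects of type $(b^k,\widetilde{\chi_p^r})$, where $\widetilde{\chi_p^r}(b^j)=\exp(2\pi i\,rj/p)\exp(-2\pi i\,u[k][j]/p^2)$ on $C_G(b^k)=\langle b\rangle$. If $X$ and $Y$ are any objects of type $(a^l,\chi_q^s)$ and $Z$ is any object of type $(b^k,\widetilde{\chi_p^r})$, then for every integer $t$ with $2t\equiv k \pmod p$ $$B_{X,Y,Z}=B_{(a^l,\chi_q^s),(a^l,\chi_q^s),(b^k,\chi_p^r)}=pq\sum_{m=0}^{p-1}\exp\left(\frac{2\pi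 i\,sl}{q}(n^{-t}-n^t)(n^m-n^{-m})\right).$$ In particular this value does not depend on $u$ (nor on $r$). -/

import Mathlib

open CategoryTheory MonoidalCategory
open scoped TensorProduct

/-- A normalized `3`-cocycle on `G` with values in `ℂˣ` (trivial action). -/
structure Cocycle3 (G : Type) [Group G] where
  toFun : G → G → G → ℂˣ
  cocycle : ∀ g h k l : G,
    toFun h k l * toFun g (h * k) l * toFun g h k = toFun (g * h) k l * toFun g h (k * l)
  one_left : ∀ h k : G, toFun 1 h k = 1
  one_mid : ∀ g k : G, toFun g 1 k = 1
  one_right : ∀ g h : G, toFun g h 1 = 1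

/-- The pointwise power `ω ^ u` of a cocycle. -/
def Cocycle3.power {G : Type} [Group G] (ω : Cocycle3 G) (u : ℕ) : Cocycle3 G where
  toFun g h k := ω.toFun g h k ^ u
  cocycle g h k l := by simp only [← mul_pow, ω.cocycle]
  one_left h k := by simp [ω.one_left]
  one_mid g k := by simp [ω.one_mid]
  one_right g h := by simp [ω.one_right]

/-- The inflation of a cocycle along a group homomorphism. -/
def Cocycle3.inflate {G H : Type} [Group G] [Group H] (ω : Cocycle3 H) (f : G →* H) :
    Cocycle3 G where
  toFun g h k := ω.toFun (f g) (f h) (f k)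
  cocycle g h k l := by simp only [map_mul, ω.cocycle]
  one_left h k := by simp [ω.one_left]
  one_mid g k := by simp [ω.one_mid]
  one_right g h := by simp [ω.one_right]

/-- An object of `Vect_G^ω`: a finite-dimensional complex vector space `V` with a `G`-grading
`V = ⨁ V_g`, the grading being recorded by the projections `proj g` of `V` onto `V_g`.
The objects do not depend on `ω`, only the monoidal structure below does. -/
structure VectG {G : Type} [Group G] [Fintype G] (ω : Cocycle3 G) where
  carrier : Type
  [addCommGroup : AddCommGroup carrier]
  [module : Module ℂ carrier]
  [finite : FiniteDimensional ℂ carrier]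
  proj : G → carrier →ₗ[ℂ] carrier
  proj_self : ∀ g v, proj g (proj g v) = proj g v
  proj_ne : ∀ g h v, g ≠ h → proj g (proj h v) = 0
  sum_proj : ∀ v, ∑ g, proj g v = v

attribute [instance] VectG.addCommGroup VectG.module VectG.finite

namespace VectG

section

variable {G : Type} [Group G] [Fintype G] {ω : Cocycle3 G}

/-- Morphisms of `Vect_G^ω`: linear maps preserving the degree. -/
@[ext]
structure Hom (V W : VectG ω) where
  lin : V.carrier →ₗ[ℂ] W.carrier
  comm : ∀ g v, W.proj g (lin v) = lin (V.proj g v)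

instance : Category (VectG ω) where
  Hom := Hom
  id V := ⟨LinearMap.id, fun _ _ => rfl⟩
  comp f g := ⟨g.lin ∘ₗ f.lin, fun x v => by simp [f.comm, g.comm]⟩

@[ext]
theorem hom_ext {V W : VectG ω} {f g : V ⟶ W} (h : f.lin = g.lin) : f = g := Hom.ext h

@[simp]
theorem id_lin (V : VectG ω) : Hom.lin (𝟙 V) = LinearMap.id := rfl

@[simp]
theorem comp_lin {V W X : VectG ω} (f : V ⟶ W) (g : W ⟶ X) :
    (f ≫ g).lin = g.lin ∘ₗ f.lin := rfl

/-- `v` is homogeneous of degree `g` (or zero). -/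
def IsHomog (V : VectG ω) (g : G) (v : V.carrier) : Prop := V.proj g v = v

theorem isHomog_proj (V : VectG ω) (g : G) (v : V.carrier) : V.IsHomog g (V.proj g v) :=
  V.proj_self g v

theorem IsHomog.proj_eq [DecidableEq G] {V : VectG ω} {g : G} {v : V.carrier} (hv : V.IsHomog g v)
    (h : G) : V.proj h v = if h = g then v else 0 := by
  split_ifs with e
  · rw [e]; exact hv
  · rw [← show V.proj g v = v from hv]; exact V.proj_ne h g v e

theorem lin_ext_homog {V : VectG ω} {M : Type} [AddCommGroup M] [Module ℂ M]
    {f f' : V.carrier →ₗ[ℂ] M} (H : ∀ g v, V.IsHomog g v → f v = f' v) : f = f' := by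
  ext v
  rw [← V.sum_proj v, map_sum, map_sum]
  exact Finset.sum_congr rfl fun g _ => H g _ (V.isHomog_proj g v)

theorem Hom.isHomog {V W : VectG ω} (f : Hom V W) {g : G} {v : V.carrier} (hv : V.IsHomog g v) :
    W.IsHomog g (f.lin v) := by
  unfold IsHomog at *
  rw [f.comm, hv]

/-- The degree `g` part of the projection family on the tensor product:
`(V ⊗ W)_g = ⨁_{xy = g} V_x ⊗ W_y`. -/
noncomputable def tensorProj (V W : VectG ω) (g : G) :
    V.carrier ⊗[ℂ] W.carrier →ₗ[ℂ] V.carrier ⊗[ℂ] W.carrier :=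
  ∑ x, TensorProduct.map (V.proj x) (W.proj (x⁻¹ * g))

theorem tensor_ext_homog {V W : VectG ω} {M : Type} [AddCommGroup M] [Module ℂ M]
    {f f' : V.carrier ⊗[ℂ] W.carrier →ₗ[ℂ] M}
    (H : ∀ g v h w, V.IsHomog g v → W.IsHomog h w → f (v ⊗ₜ w) = f' (v ⊗ₜ w)) : f = f' := by
  apply TensorProduct.ext
  apply lin_ext_homog
  intro g v hv
  apply lin_ext_homog
  intro h w hw
  exact H g v h w hv hw

theorem tensorProj_tmul [DecidableEq G] {V W : VectG ω} {g h : G} {v : V.carrier} {w : W.carrier}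
    (hv : V.IsHomog g v) (hw : W.IsHomog h w) (k : G) :
    tensorProj V W k (v ⊗ₜ w) = if k = g * h then v ⊗ₜ w else 0 := by
  simp only [tensorProj, LinearMap.sum_apply, TensorProduct.map_tmul]
  rw [Finset.sum_eq_single g]
  · rw [hv.proj_eq, hw.proj_eq, if_pos rfl]
    by_cases e : k = g * h
    · simp [e]
    · rw [if_neg e, if_neg, TensorProduct.tmul_zero]
      rintro rfl
      exact e (by group)
  · intro x _ hx
    rw [hv.proj_eq, if_neg hx, TensorProduct.zero_tmul]
  · simp

/-- The tensor product of graded spaces. -/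
noncomputable abbrev tensor (V W : VectG ω) : VectG ω where
  carrier := V.carrier ⊗[ℂ] W.carrier
  proj := tensorProj V W
  proj_self := by
    classical
    intro k
    suffices tensorProj V W k ∘ₗ tensorProj V W k = tensorProj V W k from LinearMap.congr_fun this
    apply tensor_ext_homog
    intro g v h w hv hw
    simp only [LinearMap.comp_apply, tensorProj_tmul hv hw]
    split_ifs with e
    · rw [tensorProj_tmul hv hw, if_pos e]
    · simp
  proj_ne := by
    classical
    intro k l z hkl
    suffices tensorProj V W k ∘ₗ tensorProj V W l = 0 from LinearMap.congr_fun this z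
    apply tensor_ext_homog
    intro g v h w hv hw
    simp only [LinearMap.comp_apply, tensorProj_tmul hv hw]
    split_ifs with e
    · rw [tensorProj_tmul hv hw, if_neg (e ▸ hkl)]
      simp
    · simp
  sum_proj := by
    classical
    intro z
    suffices (∑ k, tensorProj V W k) = LinearMap.id by
      simpa using LinearMap.congr_fun this z
    apply tensor_ext_homog
    intro g v h w hv hw
    simp [tensorProj_tmul hv hw]

theorem IsHomog.tmul {V W : VectG ω} {g h : G} {v : V.carrier} {w : W.carrier}
    (hv : V.IsHomog g v) (hw : W.IsHomog h w) :
    (tensor V W).IsHomog (g * h) (v ⊗ₜ w) := by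
  classical
  exact (tensorProj_tmul hv hw _).trans (if_pos rfl)

/-- A linear map that carries homogeneous elements to homogeneous elements of the same degree
commutes with the projections. -/
theorem comm_of_isHomog {V W : VectG ω} (f : V.carrier →ₗ[ℂ] W.carrier)
    (H : ∀ g v, V.IsHomog g v → W.IsHomog g (f v)) (g : G) (v : V.carrier) :
    W.proj g (f v) = f (V.proj g v) := by
  classical
  suffices W.proj g ∘ₗ f = f ∘ₗ V.proj g from LinearMap.congr_fun this v
  apply lin_ext_homog
  intro h v hv
  simp only [LinearMap.comp_apply, (H h v hv).proj_eq, hv.proj_eq]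
  split_ifs <;> simp

theorem comm_of_tmul {V W X : VectG ω} (f : V.carrier ⊗[ℂ] W.carrier →ₗ[ℂ] X.carrier)
    (H : ∀ g v h w, V.IsHomog g v → W.IsHomog h w → X.IsHomog (g * h) (f (v ⊗ₜ w)))
    (k : G) (z : (tensor V W).carrier) :
    X.proj k (f z) = f ((tensor V W).proj k z) := by
  classical
  suffices X.proj k ∘ₗ f = f ∘ₗ tensorProj V W k from LinearMap.congr_fun this z
  apply tensor_ext_homog
  intro g v h w hv hw
  simp only [LinearMap.comp_apply, (H g v h w hv hw).proj_eq, tensorProj_tmul hv hw]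
  split_ifs <;> simp

/-- The tensor product of morphisms. -/
noncomputable def tensorHom {V V' W W' : VectG ω} (f : Hom V V') (f' : Hom W W') :
    Hom (tensor V W) (tensor V' W') where
  lin := TensorProduct.map f.lin f'.lin
  comm := comm_of_tmul (X := tensor V' W') _ fun _ _ _ _ hv hw =>
    (f.isHomog hv).tmul (f'.isHomog hw)

/-- Multiplication by `c x y z` on `U_x ⊗ (V_y ⊗ W_z)`. -/
noncomputable def scale (U V W : VectG ω) (c : G → G → G → ℂˣ) :
    U.carrier ⊗[ℂ] (V.carrier ⊗[ℂ] W.carrier) →ₗ[ℂ]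
      U.carrier ⊗[ℂ] (V.carrier ⊗[ℂ] W.carrier) :=
  ∑ x, ∑ y, ∑ z, ((c x y z : ℂˣ) : ℂ) •
    TensorProduct.map (U.proj x) (TensorProduct.map (V.proj y) (W.proj z))

theorem scale_tmul {U V W : VectG ω} (c : G → G → G → ℂˣ) {x y z : G} {u : U.carrier}
    {v : V.carrier} {w : W.carrier} (hu : U.IsHomog x u) (hv : V.IsHomog y v)
    (hw : W.IsHomog z w) :
    scale U V W c (u ⊗ₜ (v ⊗ₜ w)) = ((c x y z : ℂˣ) : ℂ) • (u ⊗ₜ (v ⊗ₜ w)) := by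
  classical
  simp only [scale, LinearMap.sum_apply, LinearMap.smul_apply, TensorProduct.map_tmul,
    hu.proj_eq, hv.proj_eq, hw.proj_eq]
  rw [Finset.sum_eq_single x, Finset.sum_eq_single y, Finset.sum_eq_single z]
  · simp
  all_goals simp +contextual

theorem tensor_ext_homog₃ {U V W : VectG ω} {M : Type} [AddCommGroup M] [Module ℂ M]
    {f f' : (U.carrier ⊗[ℂ] V.carrier) ⊗[ℂ] W.carrier →ₗ[ℂ] M}
    (H : ∀ x u y v z w, U.IsHomog x u → V.IsHomog y v → W.IsHomog z w →
      f ((u ⊗ₜ v) ⊗ₜ w) = f' ((u ⊗ₜ v) ⊗ₜ w)) : f = f' := by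
  apply TensorProduct.ext
  apply tensor_ext_homog
  intro x u y v hu hv
  apply lin_ext_homog
  intro z w hw
  exact H x u y v z w hu hv hw

theorem tensor_ext_homog₃' {U V W : VectG ω} {M : Type} [AddCommGroup M] [Module ℂ M]
    {f f' : U.carrier ⊗[ℂ] (V.carrier ⊗[ℂ] W.carrier) →ₗ[ℂ] M}
    (H : ∀ x u y v z w, U.IsHomog x u → V.IsHomog y v → W.IsHomog z w →
      f (u ⊗ₜ (v ⊗ₜ w)) = f' (u ⊗ₜ (v ⊗ₜ w))) : f = f' := by
  apply TensorProduct.ext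
  apply lin_ext_homog
  intro x u hu
  apply tensor_ext_homog
  intro y v z w hv hw
  exact H x u y v z w hu hv hw

/-- The underlying linear map of the associativity constraint:
`(u ⊗ v) ⊗ w ↦ ω(|u|, |v|, |w|) u ⊗ (v ⊗ w)` on homogeneous elements. -/
noncomputable def assocLin (U V W : VectG ω) :
    (U.carrier ⊗[ℂ] V.carrier) ⊗[ℂ] W.carrier →ₗ[ℂ] U.carrier ⊗[ℂ] (V.carrier ⊗[ℂ] W.carrier) :=
  scale U V W ω.toFun ∘ₗ (TensorProduct.assoc ℂ U.carrier V.carrier W.carrier).toLinearMap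

noncomputable def assocInvLin (U V W : VectG ω) :
    U.carrier ⊗[ℂ] (V.carrier ⊗[ℂ] W.carrier) →ₗ[ℂ] (U.carrier ⊗[ℂ] V.carrier) ⊗[ℂ] W.carrier :=
  (TensorProduct.assoc ℂ U.carrier V.carrier W.carrier).symm.toLinearMap ∘ₗ
    scale U V W (fun x y z => (ω.toFun x y z)⁻¹)

theorem assocLin_tmul {U V W : VectG ω} {x y z : G} {u : U.carrier}
    {v : V.carrier} {w : W.carrier} (hu : U.IsHomog x u) (hv : V.IsHomog y v)
    (hw : W.IsHomog z w) :
    assocLin U V W ((u ⊗ₜ v) ⊗ₜ w) = ((ω.toFun x y z : ℂˣ) : ℂ) • (u ⊗ₜ (v ⊗ₜ w)) := by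
  simp [assocLin, scale_tmul _ hu hv hw]

theorem assocInvLin_tmul {U V W : VectG ω} {x y z : G} {u : U.carrier}
    {v : V.carrier} {w : W.carrier} (hu : U.IsHomog x u) (hv : V.IsHomog y v)
    (hw : W.IsHomog z w) :
    assocInvLin U V W (u ⊗ₜ (v ⊗ₜ w)) =
      (((ω.toFun x y z)⁻¹ : ℂˣ) : ℂ) • ((u ⊗ₜ v) ⊗ₜ w) := by
  simp [assocInvLin, scale_tmul _ hu hv hw]

theorem IsHomog.smul {V : VectG ω} {g : G} {v : V.carrier} (hv : V.IsHomog g v) (c : ℂ) :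
    V.IsHomog g (c • v) := by
  unfold IsHomog at *
  rw [map_smul, hv]

theorem comm_of_tmul₃ {U V W X : VectG ω}
    (f : (U.carrier ⊗[ℂ] V.carrier) ⊗[ℂ] W.carrier →ₗ[ℂ] X.carrier)
    (H : ∀ x u y v z w, U.IsHomog x u → V.IsHomog y v → W.IsHomog z w →
      X.IsHomog (x * y * z) (f ((u ⊗ₜ v) ⊗ₜ w)))
    (k : G) (t : (tensor (tensor U V) W).carrier) :
    X.proj k (f t) = f ((tensor (tensor U V) W).proj k t) := by
  classical
  suffices X.proj k ∘ₗ f = f ∘ₗ tensorProj (tensor U V) W k from LinearMap.congr_fun this t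
  apply tensor_ext_homog₃
  intro x u y v z w hu hv hw
  simp only [LinearMap.comp_apply, (H x u y v z w hu hv hw).proj_eq,
    tensorProj_tmul (hu.tmul hv) hw]
  split_ifs <;> simp

theorem comm_of_tmul₃' {U V W X : VectG ω}
    (f : U.carrier ⊗[ℂ] (V.carrier ⊗[ℂ] W.carrier) →ₗ[ℂ] X.carrier)
    (H : ∀ x u y v z w, U.IsHomog x u → V.IsHomog y v → W.IsHomog z w →
      X.IsHomog (x * (y * z)) (f (u ⊗ₜ (v ⊗ₜ w))))
    (k : G) (t : (tensor U (tensor V W)).carrier) :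
    X.proj k (f t) = f ((tensor U (tensor V W)).proj k t) := by
  classical
  suffices X.proj k ∘ₗ f = f ∘ₗ tensorProj U (tensor V W) k from LinearMap.congr_fun this t
  apply tensor_ext_homog₃'
  intro x u y v z w hu hv hw
  simp only [LinearMap.comp_apply, (H x u y v z w hu hv hw).proj_eq,
    tensorProj_tmul hu (hv.tmul hw)]
  split_ifs <;> simp

/-- The associativity constraint of `Vect_G^ω`. -/
noncomputable def assocIso (U V W : VectG ω) :
    tensor (tensor U V) W ≅ tensor U (tensor V W) where
  hom :=
    { lin := assocLin U V W
      comm := comm_of_tmul₃ (X := tensor U (tensor V W)) _ fun x u y v z w hu hv hw => by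
        rw [assocLin_tmul hu hv hw, mul_assoc]
        exact (hu.tmul (hv.tmul hw)).smul _ }
  inv :=
    { lin := assocInvLin U V W
      comm := comm_of_tmul₃' (X := tensor (tensor U V) W) _ fun x u y v z w hu hv hw => by
        rw [assocInvLin_tmul hu hv hw, ← mul_assoc]
        exact ((hu.tmul hv).tmul hw).smul _ }
  hom_inv_id := by
    apply hom_ext
    apply tensor_ext_homog₃
    intro x u y v z w hu hv hw
    simp only [comp_lin, id_lin, LinearMap.comp_apply, LinearMap.id_apply]
    rw [assocLin_tmul hu hv hw, map_smul, assocInvLin_tmul hu hv hw, smul_smul, Units.mul_inv,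
      one_smul]
  inv_hom_id := by
    apply hom_ext
    apply tensor_ext_homog₃'
    intro x u y v z w hu hv hw
    simp only [comp_lin, id_lin, LinearMap.comp_apply, LinearMap.id_apply]
    rw [assocInvLin_tmul hu hv hw, map_smul, assocLin_tmul hu hv hw, smul_smul, Units.inv_mul,
      one_smul]

open scoped Classical in
/-- The one-dimensional object `ℂ`, in degree `c`. -/
noncomputable abbrev delta (ω : Cocycle3 G) (c : G) : VectG ω where
  carrier := ℂ
  proj g := if g = c then LinearMap.id else 0
  proj_self := by
    intro g v
    split_ifs <;> simp
  proj_ne := by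
    intro g h v hne
    split_ifs with h1 h2 <;> simp_all
  sum_proj := by
    intro v
    have (x : G) : (if x = c then (LinearMap.id : ℂ →ₗ[ℂ] ℂ) else 0) v = if x = c then v else 0 := by
      split_ifs <;> rfl
    simp [this]

theorem delta_isHomog (c : G) (a : ℂ) : (delta ω c).IsHomog c a := by
  simp [IsHomog]

theorem delta_eq_zero {c g : G} {a : ℂ}
    (ha : (delta ω c).IsHomog g a) (hg : g ≠ c) : a = 0 := by
  have h := ha.symm
  simpa [IsHomog, hg] using h

/-- The left unit constraint `1 ⊗ v ↦ v`. -/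
noncomputable def leftUnitIso (V : VectG ω) : tensor (delta ω 1) V ≅ V where
  hom :=
    { lin := (TensorProduct.lid ℂ V.carrier).toLinearMap
      comm := comm_of_tmul (V := delta ω 1) (X := V) _ fun g a h v ha hv => by
        by_cases hg : g = 1
        · subst hg
          simpa using hv.smul a
        · rw [delta_eq_zero ha hg]
          simp [IsHomog] }
  inv :=
    { lin := (TensorProduct.lid ℂ V.carrier).symm.toLinearMap
      comm := comm_of_isHomog (W := tensor (delta ω 1) V) _ fun g v hv => by
        simpa using (delta_isHomog (ω := ω) 1 1).tmul hv }
  hom_inv_id := by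
    apply hom_ext
    exact LinearMap.ext fun v => (TensorProduct.lid ℂ V.carrier).symm_apply_apply v
  inv_hom_id := by
    apply hom_ext
    exact LinearMap.ext fun v => (TensorProduct.lid ℂ V.carrier).apply_symm_apply v

/-- The right unit constraint `v ⊗ 1 ↦ v`. -/
noncomputable def rightUnitIso (V : VectG ω) : tensor V (delta ω 1) ≅ V where
  hom :=
    { lin := (TensorProduct.rid ℂ V.carrier).toLinearMap
      comm := comm_of_tmul (W := delta ω 1) (X := V) _ fun h v g a hv ha => by
        by_cases hg : g = 1
        · subst hg
          simpa using hv.smul a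
        · rw [delta_eq_zero ha hg]
          simp [IsHomog] }
  inv :=
    { lin := (TensorProduct.rid ℂ V.carrier).symm.toLinearMap
      comm := comm_of_isHomog (W := tensor V (delta ω 1)) _ fun g v hv => by
        simpa using hv.tmul (delta_isHomog (ω := ω) 1 1) }
  hom_inv_id := by
    apply hom_ext
    exact LinearMap.ext fun v => (TensorProduct.rid ℂ V.carrier).symm_apply_apply v
  inv_hom_id := by
    apply hom_ext
    exact LinearMap.ext fun v => (TensorProduct.rid ℂ V.carrier).apply_symm_apply v

noncomputable instance : MonoidalCategoryStruct (VectG ω) where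
  tensorObj := tensor
  whiskerLeft U _ _ f := tensorHom (𝟙 U) f
  whiskerRight f U := tensorHom f (𝟙 U)
  tensorHom f g := tensorHom f g
  tensorUnit := delta ω 1
  associator := assocIso
  leftUnitor := leftUnitIso
  rightUnitor := rightUnitIso

noncomputable instance : MonoidalCategory (VectG ω) :=
  MonoidalCategory.ofTensorHom
    (id_tensorHom_id := fun U V => hom_ext (by
      exact TensorProduct.map_id))
    (id_tensorHom := fun _ _ _ _ => rfl)
    (tensorHom_id := fun _ _ => rfl)
    (tensorHom_comp_tensorHom := fun f₁ f₂ g₁ g₂ => hom_ext (by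
      exact (TensorProduct.map_comp _ _ _ _).symm))
    (associator_naturality := fun f₁ f₂ f₃ => hom_ext (by
      apply tensor_ext_homog₃
      intro x u y v z w hu hv hw
      change assocLin _ _ _ ((f₁.lin u ⊗ₜ f₂.lin v) ⊗ₜ f₃.lin w) =
        TensorProduct.map f₁.lin (TensorProduct.map f₂.lin f₃.lin)
          (assocLin _ _ _ ((u ⊗ₜ v) ⊗ₜ w))
      rw [assocLin_tmul hu hv hw,
        assocLin_tmul (Hom.isHomog f₁ hu) (Hom.isHomog f₂ hv) (Hom.isHomog f₃ hw), map_smul]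
      rfl))
    (leftUnitor_naturality := fun f => hom_ext (by
      apply TensorProduct.ext'
      intro a v
      exact ((f.lin).map_smul a v).symm))
    (rightUnitor_naturality := fun f => hom_ext (by
      apply TensorProduct.ext'
      intro v a
      exact ((f.lin).map_smul a v).symm))
    (pentagon := fun U V W X => hom_ext (by
      apply TensorProduct.ext
      apply tensor_ext_homog₃
      intro x u y v z w hu hv hw
      apply lin_ext_homog
      intro t p hp
      change TensorProduct.map LinearMap.id (assocLin V W X) (assocLin U (tensor V W) X
          (TensorProduct.map (assocLin U V W) LinearMap.id (((u ⊗ₜ v) ⊗ₜ w) ⊗ₜ p))) =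
        assocLin U V (tensor W X) (assocLin (tensor U V) W X (((u ⊗ₜ v) ⊗ₜ w) ⊗ₜ p))
      rw [TensorProduct.map_tmul, assocLin_tmul hu hv hw, assocLin_tmul (hu.tmul hv) hw hp,
        map_smul, assocLin_tmul hu hv (hw.tmul hp), ← TensorProduct.smul_tmul', map_smul, map_smul]
      rw [LinearMap.id_apply, assocLin_tmul hu (hv.tmul hw) hp, map_smul, TensorProduct.map_tmul,
        assocLin_tmul hv hw hp, TensorProduct.tmul_smul, LinearMap.id_apply, smul_smul, smul_smul,
        smul_smul, ← Units.val_mul, ← Units.val_mul, ← Units.val_mul, ← ω.cocycle]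
      congr 2
      ac_rfl))
    (triangle := fun U V => hom_ext (by
      apply tensor_ext_homog₃
      intro x u y a z v hu ha hv
      by_cases hy : y = 1
      · subst hy
        change TensorProduct.map LinearMap.id (TensorProduct.lid ℂ V.carrier).toLinearMap
          (assocLin U (delta ω 1) V ((u ⊗ₜ a) ⊗ₜ v)) =
            TensorProduct.map (TensorProduct.rid ℂ U.carrier).toLinearMap LinearMap.id
              ((u ⊗ₜ a) ⊗ₜ v)
        rw [assocLin_tmul (V := delta ω 1) hu ha hv, ω.one_mid]
        simp [TensorProduct.smul_tmul]
      · have : a = 0 := delta_eq_zero ha hy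
        subst this
        simp))

end

end VectG

section Center

/-- The braiding `σ_{X,Y} : X ⊗ Y ≅ Y ⊗ X` of the right Drinfeld center, in which the half-braiding
`σ_{V,W} : V ⊗ W ≅ W ⊗ V` belongs to the right-hand factor `W`. A right half-braiding on `W` is the
inverse of a half-braiding `W ⊗ V ≅ V ⊗ W` in the sense of `CategoryTheory.HalfBraiding`, so the
right center is `CategoryTheory.Center` with the reverse braiding. -/
noncomputable def rightBraiding {C : Type*} [Category* C] [MonoidalCategory C] (X Y : Center C) :
    X ⊗ Y ≅ Y ⊗ X :=
  (β_ Y X).symm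

/-- The image of `σ₂⁻¹ σ₁` (first `σ₁`, then `σ₂⁻¹`) on `(X ⊗ Y) ⊗ Z`. -/
noncomputable def borromeanStep {C : Type*} [Category* C] [MonoidalCategory C] (X Y Z : Center C) :
    (X ⊗ Y) ⊗ Z ⟶ (Y ⊗ Z) ⊗ X :=
  (rightBraiding X Y).hom ▷ Z ≫ (α_ Y X Z).hom ≫ Y ◁ (rightBraiding Z X).inv ≫ (α_ Y Z X).inv

/-- The image of `(σ₂⁻¹ σ₁)³` on `(X ⊗ Y) ⊗ Z`; the closure of this braid is the borromean link. -/
noncomputable def borromeanBraid {C : Type*} [Category* C] [MonoidalCategory C] (X Y Z : Center C) :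
    (X ⊗ Y) ⊗ Z ⟶ (X ⊗ Y) ⊗ Z :=
  borromeanStep X Y Z ≫ borromeanStep Y Z X ≫ borromeanStep Z X Y

variable {G : Type} [Group G] [Fintype G] {ω : Cocycle3 G}

/-- The borromean tensor `B_{X,Y,Z}` of the Drinfeld center of `Vect_G^ω`. The pivotal trace, for
the canonical pivotal structure, is the trace of the underlying linear map. -/
noncomputable def borromeanTensor (X Y Z : Center (VectG ω)) : ℂ :=
  LinearMap.trace ℂ ((X ⊗ Y) ⊗ Z).1.carrier (borromeanBraid X Y Z).f.lin

/-- The action `c ▹ -` of `c : G` on an object `X` of the center: the half-braiding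
`σ_{V,X} : V ⊗ X → X ⊗ V` is `v ⊗ x ↦ (c ▹ x) ⊗ v` for `v` homogeneous of degree `c`, so the
action is read off from the one-dimensional `V` of degree `c`. -/
noncomputable def centerAction (X : Center (VectG ω)) (c : G) :
    X.1.carrier →ₗ[ℂ] X.1.carrier :=
  (TensorProduct.rid ℂ X.1.carrier).toLinearMap ∘ₗ
    (X.2.β (VectG.delta ω c)).inv.lin ∘ₗ
      (TensorProduct.lid ℂ X.1.carrier).symm.toLinearMap

/-- `X` is the object of the Drinfeld center of `Vect_G^ω` that corresponds to `(g, χ)`: the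
degrees of `X` form the conjugacy class of `g`, and `χ` is the (projective) character of the
centralizer of `g` on the component `X_g`. The trace of `c ▹ -` on `X_g` is computed on all of `X`
by first projecting to `X_g`. In particular `dim X_g = χ 1`. If `χ` is irreducible, then `X` is
simple and is determined by `(g, χ)` up to isomorphism. -/
structure HasType (X : Center (VectG ω)) (g : G) (χ : Subgroup.centralizer {g} → ℂ) : Prop where
  support : ∀ x : G, X.1.proj x ≠ 0 ↔ IsConj g x
  character : ∀ c : Subgroup.centralizer {g},
    LinearMap.trace ℂ X.1.carrier (centerAction X c ∘ₗ X.1.proj g) = χ c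

end Center

section Example

/-- `exp (2πi x / N)` for a residue class `x` modulo `N`. -/
noncomputable def expZMod (N : ℕ) (x : ZMod N) : ℂ :=
  Complex.exp (2 * Real.pi * Complex.I * (x.val : ℂ) / (N : ℂ))

variable {p q : ℕ} [NeZero p]

/-- The action of `ℤ/p = ⟨b⟩` on `ℤ/q = ⟨a⟩` (both written multiplicatively) with
`b ^ k` acting by `a ^ l ↦ a ^ (n ^ k * l)`, where `n ^ p = 1` in `(ℤ/q)ˣ`. -/
def conjAction (n : (ZMod q)ˣ) (hn : n ^ p = 1) :
    Multiplicative (ZMod p) →* MulAut (Multiplicative (ZMod q)) :=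
  MonoidHom.mk'
    (fun k => AddEquiv.toMultiplicative (DistribMulAction.toAddEquiv (ZMod q) (n ^ k.toAdd.val)))
    (by
      intro i j
      have h : n ^ (i * j).toAdd.val = n ^ i.toAdd.val * n ^ j.toAdd.val := by
        rw [← pow_add, toAdd_mul, ZMod.val_add]
        exact (pow_eq_pow_mod _ hn).symm
      rw [toAdd_mul] at h
      ext x
      simp [h, mul_smul])

/-- The group `ℤ/q ⋊ ℤ/p = ⟨a, b | a ^ q = b ^ p = 1, b a b⁻¹ = a ^ n⟩`. -/
abbrev PQGroup (n : (ZMod q)ˣ) (hn : n ^ p = 1) : Type :=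
  Multiplicative (ZMod q) ⋊[conjAction n hn] Multiplicative (ZMod p)

noncomputable instance [NeZero q] (n : (ZMod q)ˣ) (hn : n ^ p = 1) : Fintype (PQGroup n hn) :=
  Fintype.ofEquiv _ SemidirectProduct.equivProd.symm

/-- The element `a ^ l`. -/
def powA (n : (ZMod q)ˣ) (hn : n ^ p = 1) (l : ZMod q) : PQGroup n hn :=
  SemidirectProduct.inl (Multiplicative.ofAdd l)

/-- The element `b ^ k`. -/
def powB (n : (ZMod q)ˣ) (hn : n ^ p = 1) (k : ZMod p) : PQGroup n hn :=
  SemidirectProduct.inr (Multiplicative.ofAdd k)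

/-- The cocycle `ω(b^i, b^j, b^k) = exp (2πi / p² * [i] ([j] + [k] - [j + k]))` on `ℤ/p = ⟨b⟩`,
where `[i] ∈ {0, …, p - 1}` represents `i`. -/
noncomputable def cyclicCocycle (p : ℕ) [NeZero p] : Cocycle3 (Multiplicative (ZMod p)) where
  toFun i j k := Units.mk0
    (Complex.exp (2 * Real.pi * Complex.I / (p : ℂ) ^ 2 *
      ((i.toAdd.val : ℂ) * ((j.toAdd.val : ℂ) + (k.toAdd.val : ℂ) - ((j * k).toAdd.val : ℂ)))))
    (Complex.exp_ne_zero _)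
  cocycle := by
    have hp : (p : ℂ) ≠ 0 := Nat.cast_ne_zero.mpr (NeZero.ne p)
    have carry : ∀ x y : Multiplicative (ZMod p), ∃ d : ℕ,
        (x.toAdd.val : ℂ) + (y.toAdd.val : ℂ) - ((x * y).toAdd.val : ℂ) = p * d := by
      intro x y
      refine ⟨(x.toAdd.val + y.toAdd.val) / p, ?_⟩
      have h := Nat.mod_add_div (x.toAdd.val + y.toAdd.val) p
      rw [← ZMod.val_add, ← toAdd_mul] at h
      have h' := congrArg (Nat.cast : ℕ → ℂ) h
      push_cast at h'
      linear_combination -h'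
    intro g h k l
    apply Units.ext
    simp only [Units.val_mul, Units.val_mk0, ← Complex.exp_add]
    obtain ⟨d, hd⟩ := carry g h
    obtain ⟨e, he⟩ := carry k l
    rw [Complex.exp_eq_exp_iff_exists_int]
    refine ⟨d * e, ?_⟩
    have hd' : ((g * h).toAdd.val : ℂ) = g.toAdd.val + h.toAdd.val - p * d := by
      linear_combination -hd
    push_cast
    rw [mul_assoc h k l, hd', he]
    field_simp
    linear_combination (g.toAdd.val : ℂ) * he
  one_left h k := by ext; simp
  one_mid g k := by ext; simp
  one_right g h := by ext; simp

/-- The cocycle `ω ^ u` on `ℤ/q ⋊ ℤ/p`, inflated from `ℤ/p`. -/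
noncomputable def pqCocycle (n : (ZMod q)ˣ) (hn : n ^ p = 1) (u : ℕ) : Cocycle3 (PQGroup n hn) :=
  ((cyclicCocycle p).inflate SemidirectProduct.rightHom).power u

/-- The character `χ_q ^ s` of `C_G(a ^ l) = ⟨a⟩`: `a ^ j ↦ exp (2πi s j / q)`. -/
noncomputable def charA (n : (ZMod q)ˣ) (hn : n ^ p = 1) (l s : ZMod q) :
    Subgroup.centralizer {powA n hn l} → ℂ :=
  fun c => expZMod q (s * (c : PQGroup n hn).left.toAdd)

/-- The projective character of `C_G(b ^ k) = ⟨b⟩` associated with `χ_p ^ r`, for the cocycle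
`ω ^ u`: `b ^ j ↦ exp (2πi r j / p) * exp (- 2πi u [k] [j] / p²)`. With the associator
`(x ⊗ y) ⊗ z ↦ ω(|x|, |y|, |z|) x ⊗ (y ⊗ z)` the action satisfies
`xy ▹ w = α_{|w|}(x, y) x ▹ y ▹ w`, whence the sign in the second factor. -/
noncomputable def charB (n : (ZMod q)ˣ) (hn : n ^ p = 1) (u : ℕ) (k r : ZMod p) :
    Subgroup.centralizer {powB n hn k} → ℂ :=
  fun c => expZMod p (r * (c : PQGroup n hn).right.toAdd) *
    Complex.exp (-(2 * Real.pi * Complex.I / (p : ℂ) ^ 2 *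
      ((u : ℂ) * (k.val : ℂ) * ((c : PQGroup n hn).right.toAdd.val : ℂ))))

end Example

/-! Naturality with respect to the morphisms from the simple object of degree `c` shows that a
half-braiding on `X` is the same as operators `c ▹ -` on `X` that carry `X_g` to `X_{cgc⁻¹}` and are
multiplicative up to values of the cocycle. Since the cocycle is normalized and inflated from `⟨b⟩`,
it equals `1` whenever one argument lies in the abelian normal subgroup `N = ⟨a⟩`.

Let `x`, `y`, `z` have degrees `g, h ∈ N` and `w`. Every associator met by the borromean braid then
has an argument in `N`, so no scalar appears. The two actions on `z` cancel, while `x` and `y` are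
acted on by the commutators `h w h⁻¹ w⁻¹` and `w⁻¹ g⁻¹ w g` (`borromeanLin_tmul`). Both lie in `N`
and preserve the degrees of `x` and `y`, so the trace is a sum over `(g, h, w)` of products of three
traces (`borromeanTensor_eq_sum`). Conjugation invariance (`trace_centerAction_conj`) reduces these
to the given characters. From `Z` only the dimension of `Z_w` enters, which is why `u` and `r`
disappear.

For `g = a^(n^i l)`, `h = a^(n^m l)`, `w = a^j b^k` and `k = 2t`, the total exponent is `s l (n^(-t)
- n^t)(n^d - n^(-d))` with `d = m - i + t`. It is independent of `j`, which gives the factor `q`;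
each `d` comes from `p` pairs `(i, m)`, which gives the factor `p` (`borromeanTensor_eq`).

Objects of both types are realized on functions on the conjugacy class, where `G` permutes the delta
functions up to scalars. The scalars have to satisfy a twisted cocycle identity
(`IsClassMultiplier`), and explicit solutions are given for `a^l` and `b^k`. -/

/-! ### Half-braidings as twisted actions -/

section CenterAction

variable {G : Type} [Group G] [Fintype G] {ω : Cocycle3 G}

/-- The linear map `X ⊗ V → V ⊗ X` underlying the half-braiding of `X`. -/
noncomputable def braidLin (X : Center (VectG ω)) (V : VectG ω) :
    X.1.carrier ⊗[ℂ] V.carrier →ₗ[ℂ] V.carrier ⊗[ℂ] X.1.carrier :=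
  (X.2.β V).hom.lin

/-- The inverse of `braidLin`. -/
noncomputable def braidInvLin (X : Center (VectG ω)) (V : VectG ω) :
    V.carrier ⊗[ℂ] X.1.carrier →ₗ[ℂ] X.1.carrier ⊗[ℂ] V.carrier :=
  (X.2.β V).inv.lin

theorem braidInvLin_comp_braidLin (X : Center (VectG ω)) (V : VectG ω) :
    braidInvLin X V ∘ₗ braidLin X V = LinearMap.id :=
  congrArg VectG.Hom.lin (X.2.β V).hom_inv_id

theorem braidLin_comp_braidInvLin (X : Center (VectG ω)) (V : VectG ω) :
    braidLin X V ∘ₗ braidInvLin X V = LinearMap.id :=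
  congrArg VectG.Hom.lin (X.2.β V).inv_hom_id

/-- The morphism out of `delta ω c` that selects a homogeneous element of degree `c`. -/
noncomputable def VectG.deltaHom {V : VectG ω} {c : G} {v : V.carrier} (hv : V.IsHomog c v) :
    VectG.Hom (VectG.delta ω c) V where
  lin := LinearMap.toSpanSingleton ℂ V.carrier v
  comm := VectG.comm_of_isHomog (V := VectG.delta ω c) _ fun g a ha => by
    by_cases hg : g = c
    · subst hg
      simpa using hv.smul a
    · rw [VectG.delta_eq_zero ha hg]
      simp [VectG.IsHomog]

/-- The inverse of `centerAction X c`. -/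
noncomputable def centerActionInv (X : Center (VectG ω)) (c : G) :
    X.1.carrier →ₗ[ℂ] X.1.carrier :=
  (TensorProduct.lid ℂ X.1.carrier).toLinearMap ∘ₗ
    braidLin X (VectG.delta ω c) ∘ₗ (TensorProduct.rid ℂ X.1.carrier).symm.toLinearMap

theorem braidLin_delta (X : Center (VectG ω)) (c : G) (x : X.1.carrier) :
    braidLin X (VectG.delta ω c) (x ⊗ₜ (1 : ℂ)) = (1 : ℂ) ⊗ₜ centerActionInv X c x :=
  ((TensorProduct.lid ℂ X.1.carrier).symm_apply_apply _).symm

theorem braidInvLin_delta (X : Center (VectG ω)) (c : G) (x : X.1.carrier) :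
    braidInvLin X (VectG.delta ω c) ((1 : ℂ) ⊗ₜ x) = centerAction X c x ⊗ₜ (1 : ℂ) :=
  ((TensorProduct.rid ℂ X.1.carrier).symm_apply_apply _).symm

theorem braidLin_tmul (X : Center (VectG ω)) {V : VectG ω} {c : G} (x : X.1.carrier)
    {v : V.carrier} (hv : V.IsHomog c v) :
    braidLin X V (x ⊗ₜ v) = v ⊗ₜ centerActionInv X c x := by
  have h : braidLin X V ∘ₗ TensorProduct.map LinearMap.id (VectG.deltaHom hv).lin =
      TensorProduct.map (VectG.deltaHom hv).lin LinearMap.id ∘ₗ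
        braidLin X (VectG.delta ω c) :=
    congrArg VectG.Hom.lin (X.2.naturality (U := VectG.delta ω c) (VectG.deltaHom hv))
  have h1 := (LinearMap.congr_fun h (x ⊗ₜ (1 : ℂ))).trans
    (congrArg (TensorProduct.map (VectG.deltaHom hv).lin LinearMap.id) (braidLin_delta X c x))
  simpa [VectG.deltaHom] using h1

theorem braidInvLin_tmul (X : Center (VectG ω)) {V : VectG ω} {c : G} (x : X.1.carrier)
    {v : V.carrier} (hv : V.IsHomog c v) :
    braidInvLin X V (v ⊗ₜ x) = centerAction X c x ⊗ₜ v := by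
  have h : TensorProduct.map LinearMap.id (VectG.deltaHom hv).lin ∘ₗ
      braidInvLin X (VectG.delta ω c) =
      braidInvLin X V ∘ₗ TensorProduct.map (VectG.deltaHom hv).lin LinearMap.id := by
    -- Naturality is an axiom for the half-braiding; inverting both sides transfers it to the
    -- inverse.
    have h0 : (X.2.β (VectG.delta ω c)).inv ≫ (X.1 ◁ VectG.deltaHom hv) =
        (VectG.deltaHom hv ▷ X.1) ≫ (X.2.β V).inv := by
      rw [Iso.inv_comp_eq, ← Category.assoc, Iso.eq_comp_inv]
      exact X.2.naturality (U := VectG.delta ω c) (VectG.deltaHom hv)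
    exact congrArg VectG.Hom.lin h0
  have h1 := (LinearMap.congr_fun h ((1 : ℂ) ⊗ₜ x)).symm.trans
    (congrArg (TensorProduct.map LinearMap.id (VectG.deltaHom hv).lin) (braidInvLin_delta X c x))
  simpa [VectG.deltaHom] using h1

theorem centerAction_comp_inv (X : Center (VectG ω)) (c : G) :
    centerAction X c ∘ₗ centerActionInv X c = LinearMap.id := by
  ext x
  have h := LinearMap.congr_fun (braidInvLin_comp_braidLin X (VectG.delta ω c)) (x ⊗ₜ (1 : ℂ))
  rw [LinearMap.comp_apply, braidLin_delta, braidInvLin_delta] at h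
  simpa using congrArg (TensorProduct.rid ℂ X.1.carrier) h

theorem centerActionInv_comp (X : Center (VectG ω)) (c : G) :
    centerActionInv X c ∘ₗ centerAction X c = LinearMap.id := by
  ext x
  have h := LinearMap.congr_fun (braidLin_comp_braidInvLin X (VectG.delta ω c)) ((1 : ℂ) ⊗ₜ x)
  rw [LinearMap.comp_apply, braidInvLin_delta, braidLin_delta] at h
  simpa using congrArg (TensorProduct.lid ℂ X.1.carrier) h

theorem centerAction_inv_apply (X : Center (VectG ω)) (c : G) (x : X.1.carrier) :
    centerAction X c (centerActionInv X c x) = x :=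
  LinearMap.congr_fun (centerAction_comp_inv X c) x

theorem centerActionInv_apply (X : Center (VectG ω)) (c : G) (x : X.1.carrier) :
    centerActionInv X c (centerAction X c x) = x :=
  LinearMap.congr_fun (centerActionInv_comp X c) x

/-- The half-braiding preserves degrees: `x ⊗ 1` has degree `g * c` and its image has a left factor
of degree `c`, so the right factor has degree `c⁻¹ * (g * c)`. -/
theorem centerActionInv_isHomog (X : Center (VectG ω)) (c : G) {g : G} {x : X.1.carrier}
    (hx : X.1.IsHomog g x) : X.1.IsHomog (c⁻¹ * g * c) (centerActionInv X c x) := by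
  have h := VectG.Hom.isHomog (X.2.β (VectG.delta ω c)).hom
    (hx.tmul (VectG.delta_isHomog (ω := ω) c 1))
  have h2 : (VectG.tensor (VectG.delta ω c) X.1).IsHomog (g * c)
      ((1 : ℂ) ⊗ₜ centerActionInv X c x) := by
    rw [← braidLin_delta]; exact h
  have h3 : (TensorProduct.lid ℂ X.1.carrier) (VectG.tensorProj (VectG.delta ω c) X.1 (g * c)
      ((1 : ℂ) ⊗ₜ centerActionInv X c x)) = centerActionInv X c x := by
    rw [h2]; simp
  rw [VectG.tensorProj, LinearMap.sum_apply, Finset.sum_eq_single c] at h3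
  · simpa [VectG.IsHomog, mul_assoc] using h3
  · intro b _ hb
    simp [hb]
  · simp

theorem centerAction_isHomog (X : Center (VectG ω)) (c : G) {g : G} {x : X.1.carrier}
    (hx : X.1.IsHomog g x) : X.1.IsHomog (c * g * c⁻¹) (centerAction X c x) := by
  have h := VectG.Hom.isHomog (X.2.β (VectG.delta ω c)).inv
    ((VectG.delta_isHomog (ω := ω) c 1).tmul hx)
  have h2 : (VectG.tensor X.1 (VectG.delta ω c)).IsHomog (c * g)
      (centerAction X c x ⊗ₜ (1 : ℂ)) := by
    rw [← braidInvLin_delta]; exact h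
  have h3 : (TensorProduct.rid ℂ X.1.carrier) (VectG.tensorProj X.1 (VectG.delta ω c) (c * g)
      (centerAction X c x ⊗ₜ (1 : ℂ))) = centerAction X c x := by
    rw [h2]; simp
  rw [VectG.tensorProj, LinearMap.sum_apply, Finset.sum_eq_single (c * g * c⁻¹)] at h3
  · simpa [VectG.IsHomog, mul_assoc] using h3
  · intro b _ hb
    have : ¬ b⁻¹ * (c * g) = c := by
      intro e
      exact hb (by rw [inv_mul_eq_iff_eq_mul, eq_comm] at e; exact eq_mul_inv_of_mul_eq e)
    simp [this]
  · simp

theorem proj_comp_centerAction (X : Center (VectG ω)) (c g : G) :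
    X.1.proj (c * g * c⁻¹) ∘ₗ centerAction X c = centerAction X c ∘ₗ X.1.proj g := by
  classical
  apply VectG.lin_ext_homog
  intro h x hx
  simp only [LinearMap.comp_apply, hx.proj_eq, (centerAction_isHomog X c hx).proj_eq,
    mul_left_inj, mul_right_inj]
  split_ifs <;> simp

/-- The multiplicativity of the action, twisted by the cocycle. -/
theorem centerActionInv_mul (X : Center (VectG ω)) (c d : G) {g : G} {x : X.1.carrier}
    (hx : X.1.IsHomog g x) :
    centerActionInv X (c * d) x =
      (((ω.toFun c d ((c * d)⁻¹ * g * (c * d)))⁻¹ * ω.toFun c (c⁻¹ * g * c) d *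
        (ω.toFun g c d)⁻¹ : ℂˣ) : ℂ) • centerActionInv X d (centerActionInv X c x) := by
  have hc := VectG.delta_isHomog (ω := ω) c 1
  have hd := VectG.delta_isHomog (ω := ω) d 1
  -- The hexagon axiom for the simple objects of degrees `c` and `d`; its three associators produce
  -- the three cocycle values.
  have h0 : braidLin X (VectG.tensor (VectG.delta ω c) (VectG.delta ω d))
      (x ⊗ₜ ((1 : ℂ) ⊗ₜ (1 : ℂ))) =
      VectG.assocInvLin (VectG.delta ω c) (VectG.delta ω d) X.1
        (TensorProduct.map LinearMap.id (braidLin X (VectG.delta ω d))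
          (VectG.assocLin (VectG.delta ω c) X.1 (VectG.delta ω d)
            (TensorProduct.map (braidLin X (VectG.delta ω c)) LinearMap.id
              (VectG.assocInvLin X.1 (VectG.delta ω c) (VectG.delta ω d)
                (x ⊗ₜ ((1 : ℂ) ⊗ₜ (1 : ℂ))))))) :=
    LinearMap.congr_fun (congrArg VectG.Hom.lin
      (X.2.monoidal (VectG.delta ω c) (VectG.delta ω d))) _
  have hx1 := centerActionInv_isHomog X c hx
  have hx2 := centerActionInv_isHomog X d hx1
  rw [braidLin_tmul X x (hc.tmul hd), VectG.assocInvLin_tmul hx hc hd, map_smul, map_smul, map_smul,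
    map_smul, TensorProduct.map_tmul, braidLin_delta, LinearMap.id_apply,
    VectG.assocLin_tmul hc hx1 hd, map_smul, map_smul, TensorProduct.map_tmul, braidLin_delta,
    LinearMap.id_apply, VectG.assocInvLin_tmul hc hd hx2] at h0
  -- Removing the factor `1 ⊗ 1` leaves an equation in `X`.
  have h1 := congrArg (TensorProduct.lid ℂ X.1.carrier ∘
    TensorProduct.map (TensorProduct.lid ℂ ℂ).toLinearMap LinearMap.id) h0
  simp only [Function.comp_apply, map_smul, TensorProduct.map_tmul, LinearMap.id_apply,
    LinearEquiv.coe_coe, TensorProduct.lid_tmul, smul_eq_mul, mul_one, one_smul, smul_smul] at h1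
  rw [h1, ← Units.val_mul, ← Units.val_mul]
  congr 2
  rw [show d⁻¹ * (c⁻¹ * g * c) * d = (c * d)⁻¹ * g * (c * d) by group]
  ac_rfl

/-- The linear map underlying `borromeanStep`. -/
noncomputable def borromeanStepLin (X Y Z : Center (VectG ω)) :
    (X.1.carrier ⊗[ℂ] Y.1.carrier) ⊗[ℂ] Z.1.carrier →ₗ[ℂ]
      (Y.1.carrier ⊗[ℂ] Z.1.carrier) ⊗[ℂ] X.1.carrier :=
  (borromeanStep X Y Z).f.lin

theorem borromeanStepLin_eq (X Y Z : Center (VectG ω)) :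
    borromeanStepLin X Y Z = VectG.assocInvLin Y.1 Z.1 X.1 ∘ₗ
      TensorProduct.map (LinearMap.id : Y.1.carrier →ₗ[ℂ] Y.1.carrier) (braidLin X Z.1) ∘ₗ
        VectG.assocLin Y.1 X.1 Z.1 ∘ₗ
          TensorProduct.map (braidInvLin Y X.1)
            (LinearMap.id : Z.1.carrier →ₗ[ℂ] Z.1.carrier) := by
  have h1 : (borromeanStep X Y Z).f =
      ((Y.2.β X.1).inv ▷ Z.1 : (X.1 ⊗ Y.1) ⊗ Z.1 ⟶ _) ≫ (α_ Y.1 X.1 Z.1).hom ≫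
        (Y.1 ◁ (X.2.β Z.1).hom) ≫ (α_ Y.1 Z.1 X.1).inv := by
    have e1 : (rightBraiding X Y).hom.f = (Y.2.β X.1).inv := by
      change inv (Y.2.β X.1).hom = _
      simp
    have e2 : (rightBraiding Z X).inv.f = (X.2.β Z.1).hom := rfl
    rw [← e1, ← e2, ← Center.associator_inv_f]
    rfl
  exact congrArg VectG.Hom.lin h1

/-- In the crossing `σ₁` the element `y` is acted on by the degree of `x`; in `σ₂⁻¹` the element `x`
is acted on by the inverse of the degree of `z`. The scalar comes from the reassociations before and
after `σ₂⁻¹`. -/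
theorem borromeanStepLin_tmul (X Y Z : Center (VectG ω)) {g h w : G} {x : X.1.carrier}
    {y : Y.1.carrier} {z : Z.1.carrier} (hx : X.1.IsHomog g x) (hy : Y.1.IsHomog h y)
    (hz : Z.1.IsHomog w z) :
    borromeanStepLin X Y Z ((x ⊗ₜ y) ⊗ₜ z) =
      ((ω.toFun (g * h * g⁻¹) g w * (ω.toFun (g * h * g⁻¹) w (w⁻¹ * g * w))⁻¹ : ℂˣ) : ℂ) •
        ((centerAction Y g y ⊗ₜ z) ⊗ₜ centerActionInv X w x) := by
  have hy1 := centerAction_isHomog Y g hy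
  have hx1 := centerActionInv_isHomog X w hx
  rw [borromeanStepLin_eq]
  simp only [LinearMap.comp_apply, TensorProduct.map_tmul, LinearMap.id_apply]
  rw [braidInvLin_tmul Y y hx, VectG.assocLin_tmul hy1 hx hz, map_smul, TensorProduct.map_tmul,
    braidLin_tmul X x hz, LinearMap.id_apply, map_smul, VectG.assocInvLin_tmul hy1 hz hx1,
    smul_smul, Units.val_mul]

end CenterAction

/-! ### The borromean trace for objects supported on an abelian normal subgroup -/

section BorromeanTrace

variable {G : Type} [Group G] [Fintype G] {ω : Cocycle3 G}

/-- `ω` takes the value `1` as soon as one of its arguments lies in `N`. -/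
def Cocycle3.TrivialOn (ω : Cocycle3 G) (N : Subgroup G) : Prop :=
  ∀ g h k, g ∈ N ∨ h ∈ N ∨ k ∈ N → ω.toFun g h k = 1

/-- Normalization of the cocycle makes this operator idempotent, and it is invertible. -/
theorem centerActionInv_one (X : Center (VectG ω)) : centerActionInv X 1 = LinearMap.id := by
  apply VectG.lin_ext_homog
  intro g x hx
  have h := centerActionInv_mul X 1 1 hx
  simp only [ω.one_left, ω.one_right, inv_one, mul_one, Units.val_one, one_smul] at h
  have h1 := congrArg (centerAction X 1) h
  rw [centerAction_inv_apply, centerAction_inv_apply] at h1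
  exact h1.symm

theorem centerAction_one (X : Center (VectG ω)) : centerAction X 1 = LinearMap.id := by
  have h := centerAction_comp_inv X 1
  rwa [centerActionInv_one, LinearMap.comp_id] at h

/-- By normality, all conjugates of `g` that occur stay in `N` if `g` does, so each of the three
cocycle values has an argument in `N`. -/
theorem centerActionInv_mul_of_trivialOn {N : Subgroup G} [N.Normal] (hN : ω.TrivialOn N)
    (X : Center (VectG ω)) {c d g : G} (hcd : c ∈ N ∨ d ∈ N ∨ g ∈ N) {x : X.1.carrier}
    (hx : X.1.IsHomog g x) :
    centerActionInv X (c * d) x = centerActionInv X d (centerActionInv X c x) := by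
  have hconj (e : G) (hg : g ∈ N) : e⁻¹ * g * e ∈ N := by
    simpa using Subgroup.Normal.conj_mem ‹N.Normal› g hg e⁻¹
  rw [centerActionInv_mul X c d hx, hN c d, hN c _ d, hN g c d]
  · simp
  · tauto
  · have := hconj c
    tauto
  · have := hconj (c * d)
    tauto

theorem centerAction_mul_of_trivialOn {N : Subgroup G} [N.Normal] (hN : ω.TrivialOn N)
    (X : Center (VectG ω)) {c d g : G} (hcd : c ∈ N ∨ d ∈ N ∨ g ∈ N) {x : X.1.carrier}
    (hx : X.1.IsHomog g x) :
    centerAction X (c * d) x = centerAction X c (centerAction X d x) := by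
  have hy := centerAction_isHomog X c (centerAction_isHomog X d hx)
  have hconj (hg : g ∈ N) : c * (d * g * d⁻¹) * c⁻¹ ∈ N :=
    Subgroup.Normal.conj_mem ‹N.Normal› _ (Subgroup.Normal.conj_mem ‹N.Normal› g hg d) c
  have h := centerActionInv_mul_of_trivialOn hN X (c := c) (d := d) (by tauto) hy
  rw [centerActionInv_apply, centerActionInv_apply] at h
  rw [← centerAction_inv_apply X (c * d) (centerAction X c _), h]

/-- For general `c` and `g` the two sides differ by a scalar coming from the cocycle; an argument in
`N` removes it. -/
theorem centerActionInv_eq_centerAction {N : Subgroup G} [N.Normal] (hN : ω.TrivialOn N)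
    (X : Center (VectG ω)) {c g : G} (hc : c ∈ N ∨ g ∈ N) {x : X.1.carrier}
    (hx : X.1.IsHomog g x) : centerActionInv X c x = centerAction X c⁻¹ x := by
  have h := centerAction_mul_of_trivialOn hN X (c := c) (d := c⁻¹) (by tauto) hx
  rw [mul_inv_cancel, centerAction_one, LinearMap.id_apply] at h
  rw [h, centerActionInv_apply, ← h]

/-- The linear map underlying `borromeanBraid`. -/
noncomputable def borromeanLin (X Y Z : Center (VectG ω)) :
    (X.1.carrier ⊗[ℂ] Y.1.carrier) ⊗[ℂ] Z.1.carrier →ₗ[ℂ]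
      (X.1.carrier ⊗[ℂ] Y.1.carrier) ⊗[ℂ] Z.1.carrier :=
  borromeanStepLin Z X Y ∘ₗ borromeanStepLin Y Z X ∘ₗ borromeanStepLin X Y Z

theorem borromeanTensor_eq_trace (X Y Z : Center (VectG ω)) :
    borromeanTensor X Y Z = LinearMap.trace ℂ _ (borromeanLin X Y Z) := rfl

/-- The degree of the `Y`-factor remains `h` throughout because `N` is abelian, so the last crossing
undoes the earlier action of `h` on `z`. The `X`-factor is acted on by `w⁻¹` and then by `h w h⁻¹`,
the degree of `h ▹ z`; the `Y`-factor by `g` and then by `w⁻¹ g⁻¹ w`. -/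
theorem borromeanLin_tmul {N : Subgroup G} [N.Normal] (hN : ω.TrivialOn N)
    (hcomm : ∀ g ∈ N, ∀ h ∈ N, g * h = h * g)
    (X Y Z : Center (VectG ω)) {g h w : G} (hg : g ∈ N) (hh : h ∈ N) {x : X.1.carrier}
    {y : Y.1.carrier} {z : Z.1.carrier} (hx : X.1.IsHomog g x) (hy : Y.1.IsHomog h y)
    (hz : Z.1.IsHomog w z) :
    borromeanLin X Y Z ((x ⊗ₜ y) ⊗ₜ z) =
      (centerAction X (h * w * h⁻¹ * w⁻¹) x ⊗ₜ centerAction Y (w⁻¹ * g⁻¹ * w * g) y) ⊗ₜ z := by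
  have hconj (e : G) {g : G} (hg : g ∈ N) : e⁻¹ * g * e ∈ N := by
    simpa using Subgroup.Normal.conj_mem ‹N.Normal› g hg e⁻¹
  have hx1 := centerActionInv_isHomog X w hx
  have hy1 : Y.1.IsHomog h (centerAction Y g y) := by
    have := centerAction_isHomog Y g hy
    rwa [hcomm g hg h hh, mul_inv_cancel_right] at this
  have hz1 := centerAction_isHomog Z h hz
  have hy2 : Y.1.IsHomog h (centerActionInv Y (w⁻¹ * g * w) (centerAction Y g y)) := by
    have := centerActionInv_isHomog Y (w⁻¹ * g * w) hy1
    rwa [mul_assoc, ← hcomm _ (hconj w hg) h hh, inv_mul_cancel_left] at this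
  rw [borromeanLin, LinearMap.comp_apply, LinearMap.comp_apply, borromeanStepLin_tmul X Y Z hx hy hz,
    map_smul, borromeanStepLin_tmul Y Z X hy1 hz hx1, map_smul, map_smul,
    borromeanStepLin_tmul Z X Y hz1 hx1 hy2, centerActionInv_apply,
    hN _ g w (by tauto), hN _ w (w⁻¹ * g * w) (by have := hconj w hg; tauto),
    hN _ h _ (by tauto), hN _ (w⁻¹ * g * w) _ (by have := hconj w hg; tauto),
    hN _ _ h (by tauto), hN _ h _ (by tauto),
    centerActionInv_eq_centerAction hN X (Or.inr hg) hx,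
    centerActionInv_eq_centerAction hN Y (Or.inr hh) hy1,
    ← centerAction_mul_of_trivialOn hN X (by tauto) hx,
    ← centerAction_mul_of_trivialOn hN Y (by tauto) hy]
  simp [mul_assoc]

/-- On each homogeneous piece the braid is a tensor product of three operators, and the trace is
multiplicative on those. Pieces with `g` or `h` outside `N` vanish by the support hypotheses. -/
theorem borromeanTensor_eq_sum {N : Subgroup G} [N.Normal] (hN : ω.TrivialOn N)
    (hcomm : ∀ g ∈ N, ∀ h ∈ N, g * h = h * g) (X Y Z : Center (VectG ω))
    (hX : ∀ g ∉ N, X.1.proj g = 0) (hY : ∀ g ∉ N, Y.1.proj g = 0) :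
    borromeanTensor X Y Z = ∑ g, ∑ h, ∑ w,
      LinearMap.trace ℂ X.1.carrier (centerAction X (h * w * h⁻¹ * w⁻¹) ∘ₗ X.1.proj g) *
        LinearMap.trace ℂ Y.1.carrier (centerAction Y (w⁻¹ * g⁻¹ * w * g) ∘ₗ Y.1.proj h) *
          LinearMap.trace ℂ Z.1.carrier (Z.1.proj w) := by
  have hT : borromeanLin X Y Z = ∑ g, ∑ h, ∑ w, TensorProduct.map
      (TensorProduct.map (centerAction X (h * w * h⁻¹ * w⁻¹) ∘ₗ X.1.proj g)
        (centerAction Y (w⁻¹ * g⁻¹ * w * g) ∘ₗ Y.1.proj h)) (Z.1.proj w) := by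
    classical
    apply VectG.tensor_ext_homog₃
    intro g x h y w z hx hy hz
    simp only [LinearMap.sum_apply, TensorProduct.map_tmul, LinearMap.comp_apply,
      hx.proj_eq, hy.proj_eq, hz.proj_eq]
    rw [Finset.sum_eq_single g, Finset.sum_eq_single h, Finset.sum_eq_single w]
    · rw [if_pos rfl, if_pos rfl, if_pos rfl]
      by_cases hg : g ∈ N
      · by_cases hh : h ∈ N
        · exact borromeanLin_tmul hN hcomm X Y Z hg hh hx hy hz
        · rw [← show Y.1.proj h y = y from hy, hY h hh]
          simp
      · rw [← show X.1.proj g x = x from hx, hX g hg]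
        simp
    all_goals simp +contextual
  rw [borromeanTensor_eq_trace, hT]
  simp only [map_sum, LinearMap.trace_tensorProduct']

/-- The operator `d ▹ -` identifies `X_g` with `X_{dgd⁻¹}` and intertwines `d⁻¹ c d` with `c`,
exactly and not only up to a scalar because `c ∈ N`. Cyclicity of the trace finishes. -/
theorem trace_centerAction_conj {N : Subgroup G} [N.Normal] (hN : ω.TrivialOn N)
    (X : Center (VectG ω)) {c : G} (hc : c ∈ N) (d g : G) :
    LinearMap.trace ℂ X.1.carrier (centerAction X c ∘ₗ X.1.proj (d * g * d⁻¹)) =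
      LinearMap.trace ℂ X.1.carrier (centerAction X (d⁻¹ * c * d) ∘ₗ X.1.proj g) := by
  have h1 : centerAction X c ∘ₗ X.1.proj (d * g * d⁻¹) =
      (centerAction X c ∘ₗ centerAction X d ∘ₗ X.1.proj g) ∘ₗ centerActionInv X d := by
    rw [← proj_comp_centerAction X d, LinearMap.comp_assoc, LinearMap.comp_assoc,
      centerAction_comp_inv, LinearMap.comp_id]
  have h2 : centerAction X c ∘ₗ centerAction X d =
      centerAction X d ∘ₗ centerAction X (d⁻¹ * c * d) := by
    apply VectG.lin_ext_homog
    intro g x hx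
    have hc' : d⁻¹ * c * d ∈ N := by
      simpa using Subgroup.Normal.conj_mem ‹N.Normal› c hc d⁻¹
    rw [LinearMap.comp_apply, LinearMap.comp_apply,
      ← centerAction_mul_of_trivialOn hN X (by tauto) hx,
      ← centerAction_mul_of_trivialOn hN X (by tauto) hx]
    group
  rw [h1, LinearMap.trace_comp_comm', ← LinearMap.comp_assoc _ _ (centerAction X c), h2,
    LinearMap.comp_assoc, ← LinearMap.comp_assoc, centerActionInv_comp, LinearMap.id_comp]

theorem trace_proj_conj {N : Subgroup G} [N.Normal] (hN : ω.TrivialOn N)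
    (X : Center (VectG ω)) (d g : G) :
    LinearMap.trace ℂ X.1.carrier (X.1.proj (d * g * d⁻¹)) =
      LinearMap.trace ℂ X.1.carrier (X.1.proj g) := by
  simpa [centerAction_one] using trace_centerAction_conj hN X N.one_mem d g

end BorromeanTrace

/-! ### Powers of `n` with exponents modulo `p`, and additive characters -/

section UnitPow

variable {p q : ℕ} [Fact p.Prime] [Fact q.Prime]

/-- The power `n ^ i` for a residue class `i` modulo `p`, where `n ^ p = 1`. -/
def unitPow (n : (ZMod q)ˣ) (i : ZMod p) : (ZMod q)ˣ := n ^ i.val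

theorem unitPow_natCast {n : (ZMod q)ˣ} (hn : n ^ p = 1) (m : ℕ) :
    unitPow n (m : ZMod p) = n ^ m := by
  rw [unitPow, ZMod.val_natCast]
  exact (pow_eq_pow_mod m hn).symm

theorem unitPow_zero (n : (ZMod q)ˣ) : unitPow n (0 : ZMod p) = 1 := by
  simp [unitPow]

theorem unitPow_add {n : (ZMod q)ˣ} (hn : n ^ p = 1) (i j : ZMod p) :
    unitPow n (i + j) = unitPow n i * unitPow n j := by
  rw [unitPow, unitPow, unitPow, ← pow_add, ZMod.val_add]
  exact (pow_eq_pow_mod _ hn).symm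

theorem unitPow_neg {n : (ZMod q)ˣ} (hn : n ^ p = 1) (i : ZMod p) :
    unitPow n (-i) = (unitPow n i)⁻¹ := by
  rw [eq_inv_iff_mul_eq_one, ← unitPow_add hn, neg_add_cancel, unitPow_zero]

theorem unitPow_intCast {n : (ZMod q)ˣ} (hn : n ^ p = 1) (t : ℤ) :
    unitPow n (t : ZMod p) = n ^ t := by
  obtain ⟨m, rfl | rfl⟩ := t.eq_nat_or_neg
  · simpa using unitPow_natCast hn m
  · rw [Int.cast_neg, Int.cast_natCast, unitPow_neg hn, unitPow_natCast hn, zpow_neg, zpow_natCast]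

theorem unitPow_injective {n : (ZMod q)ˣ} (hn : n ^ p = 1) (hn1 : n ≠ 1) :
    Function.Injective (unitPow n : ZMod p → (ZMod q)ˣ) := by
  intro i j h
  have ho : orderOf n = p := orderOf_eq_prime hn hn1
  have h1 := pow_injOn_Iio_orderOf (x := n) (by simpa [ho] using i.val_lt)
    (by simpa [ho] using j.val_lt) h
  exact ZMod.val_injective p h1

theorem expZMod_add (a b : ZMod q) : expZMod q (a + b) = expZMod q a * expZMod q b := by
  have h (x : ZMod q) : expZMod q x = ZMod.stdAddChar x := by
    rw [ZMod.stdAddChar_apply, ZMod.toCircle_apply, expZMod]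
  rw [h, h, h, AddChar.map_add_eq_mul]

end UnitPow

/-! ### Conjugation in `ℤ/q ⋊ ℤ/p` and evaluation of the borromean sum -/

section PQGroup

variable {p q : ℕ} [Fact p.Prime] {n : (ZMod q)ˣ} {hn : n ^ p = 1}

theorem powB_mul_powB (i j : ZMod p) : powB n hn i * powB n hn j = powB n hn (i + j) := by
  rw [powB, powB, powB, ofAdd_add, map_mul]

theorem powB_inv (i : ZMod p) : (powB n hn i)⁻¹ = powB n hn (-i) := by
  rw [powB, powB, ofAdd_neg, map_inv]

theorem eq_powA_mul_powB (x : PQGroup n hn) :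
    x = powA n hn x.left.toAdd * powB n hn x.right.toAdd := by
  ext <;> simp [powA, powB]

theorem powA_injective : Function.Injective (powA n hn) := fun i j h => by
  simpa [powA] using h

variable [Fact q.Prime]

theorem powA_mul_powA (i j : ZMod q) : powA n hn i * powA n hn j = powA n hn (i + j) := by
  rw [powA, powA, powA, ofAdd_add, map_mul]

theorem powA_inv (i : ZMod q) : (powA n hn i)⁻¹ = powA n hn (-i) := by
  rw [powA, powA, ofAdd_neg, map_inv]

theorem powB_mul_powA (i : ZMod p) (j : ZMod q) :
    powB n hn i * powA n hn j = powA n hn (unitPow n i * j) * powB n hn i := by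
  ext
  · simp only [powA, powB, SemidirectProduct.mul_left, SemidirectProduct.left_inl,
      SemidirectProduct.left_inr, SemidirectProduct.right_inr, one_mul, map_one, mul_one]
    rfl
  · simp [powA, powB]

theorem powB_conj_powA (i : ZMod p) (j : ZMod q) :
    powB n hn i * powA n hn j * (powB n hn i)⁻¹ = powA n hn (unitPow n i * j) := by
  rw [powB_mul_powA, mul_inv_cancel_right]

theorem powA_mul_powB_inj {i i' : ZMod q} {j j' : ZMod p} :
    powA n hn i * powB n hn j = powA n hn i' * powB n hn j' ↔ i = i' ∧ j = j' := by
  constructor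
  · intro h
    have h1 := congrArg SemidirectProduct.left h
    have h2 := congrArg SemidirectProduct.right h
    simpa [powA, powB] using And.intro h1 h2
  · rintro ⟨rfl, rfl⟩
    rfl

theorem conj_powA (i : ZMod q) (m : ZMod p) (l : ZMod q) :
    powA n hn i * powB n hn m * powA n hn l * (powA n hn i * powB n hn m)⁻¹ =
      powA n hn (unitPow n m * l) := by
  rw [mul_assoc (powA n hn i), powB_mul_powA, mul_inv_rev, powB_inv, powA_inv]
  rw [show ∀ a b c d e : PQGroup n hn, a * (b * c) * (d * e) = a * b * (c * d) * e by
    intros; group, powB_mul_powB, powA_mul_powA, add_neg_cancel,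
    show powB n hn 0 = 1 from map_one _, mul_one, powA_mul_powA]
  congr 1
  ring

theorem conj_powB (i : ZMod q) (m k : ZMod p) (j : ZMod q) :
    powA n hn i * powB n hn m * (powA n hn j * powB n hn k) * (powA n hn i * powB n hn m)⁻¹ =
      powA n hn (i + unitPow n m * j - unitPow n k * i) * powB n hn k := by
  rw [mul_inv_eq_iff_eq_mul, mul_assoc, ← mul_assoc (powB n hn m), powB_mul_powA,
    mul_assoc _ (powB n hn k), ← mul_assoc (powB n hn k) (powA n hn i), powB_mul_powA]
  simp only [mul_assoc, powB_mul_powB]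
  simp only [← mul_assoc, powA_mul_powA, powA_mul_powB_inj, add_comm m k, and_true]
  ring

theorem isConj_powA_iff (l : ZMod q) (x : PQGroup n hn) :
    IsConj (powA n hn l) x ↔ ∃ m : ZMod p, x = powA n hn (unitPow n m * l) := by
  rw [isConj_iff]
  constructor
  · rintro ⟨c, rfl⟩
    refine ⟨c.right.toAdd, ?_⟩
    rw [← conj_powA c.left.toAdd, ← eq_powA_mul_powB]
  · rintro ⟨m, rfl⟩
    exact ⟨powB n hn m, powB_conj_powA m l⟩

/-- Conjugating `b^k` by `a^i` multiplies it on the left by `a^((1 - n^k) i)`. For `k ≠ 0` the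
factor `1 - n^k` is nonzero in the field `ℤ/q`, because `n` has order `p`, so every power of `a`
arises. -/
theorem isConj_powB_iff (hn1 : n ≠ 1) {k : ZMod p} (hk : k ≠ 0) (x : PQGroup n hn) :
    IsConj (powB n hn k) x ↔ ∃ j : ZMod q, x = powA n hn j * powB n hn k := by
  have h0 : powB n hn k = powA n hn 0 * powB n hn k := by
    rw [show powA n hn 0 = 1 from map_one _, one_mul]
  rw [isConj_iff]
  constructor
  · rintro ⟨c, rfl⟩
    have h := conj_powB (n := n) (hn := hn) c.left.toAdd c.right.toAdd k 0
    rw [← h0, ← eq_powA_mul_powB] at h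
    exact ⟨_, h⟩
  · rintro ⟨j, rfl⟩
    have hk1 : (1 : ZMod q) - unitPow n k ≠ 0 := by
      intro e
      apply hk
      apply unitPow_injective hn hn1
      rw [unitPow_zero]
      exact Units.ext (sub_eq_zero.mp e).symm
    refine ⟨powA n hn (j / (1 - unitPow n k)), ?_⟩
    have h := conj_powB (n := n) (hn := hn) (j / (1 - unitPow n k)) 0 k 0
    rw [show powB n hn 0 = 1 from map_one _, mul_one, ← h0] at h
    rw [h, mul_zero, add_zero, ← one_sub_mul, mul_div_cancel₀ _ hk1]

/-- The normal subgroup `⟨a⟩`. -/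
def subgroupA (n : (ZMod q)ˣ) (hn : n ^ p = 1) : Subgroup (PQGroup n hn) :=
  SemidirectProduct.rightHom.ker

instance : (subgroupA n hn).Normal := inferInstanceAs (SemidirectProduct.rightHom.ker).Normal

theorem mem_subgroupA_iff {x : PQGroup n hn} : x ∈ subgroupA n hn ↔ ∃ j, x = powA n hn j := by
  constructor
  · intro h
    refine ⟨x.left.toAdd, ?_⟩
    ext
    · simp [powA]
    · have : x.right = 1 := h
      simp [powA, this]
  · rintro ⟨j, rfl⟩
    exact SemidirectProduct.rightHom_inl _

theorem powA_mem (j : ZMod q) : powA n hn j ∈ subgroupA n hn := mem_subgroupA_iff.mpr ⟨j, rfl⟩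

theorem subgroupA_comm : ∀ g ∈ subgroupA n hn, ∀ h ∈ subgroupA n hn, g * h = h * g := by
  intro g hg h hh
  obtain ⟨i, rfl⟩ := mem_subgroupA_iff.mp hg
  obtain ⟨j, rfl⟩ := mem_subgroupA_iff.mp hh
  rw [powA_mul_powA, powA_mul_powA, add_comm]

theorem pqCocycle_trivialOn (u : ℕ) : (pqCocycle n hn u).TrivialOn (subgroupA n hn) := by
  have hr (g : PQGroup n hn) (hg : g ∈ subgroupA n hn) : SemidirectProduct.rightHom g = 1 := hg
  rintro g h k (hg | hg | hg) <;>
    simp only [pqCocycle, Cocycle3.power, Cocycle3.inflate, hr _ hg, Cocycle3.one_left,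
      Cocycle3.one_mid, Cocycle3.one_right, one_pow]

/-- Conjugating by `b^(-m)` brings the component at `a^(n^m l)` back to `a^l`, where the character
is known, and replaces `a^j` by `a^(n^(-m) j)`. -/
theorem trace_of_hasType_powA {u : ℕ} {l s : ZMod q} {X : Center (VectG (pqCocycle n hn u))}
    (hX : HasType X (powA n hn l) (charA n hn l s)) (m : ZMod p) (j : ZMod q) :
    LinearMap.trace ℂ X.1.carrier
      (centerAction X (powA n hn j) ∘ₗ X.1.proj (powA n hn (unitPow n m * l))) =
      expZMod q (s * (unitPow n (-m) * j)) := by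
  rw [← powB_conj_powA, trace_centerAction_conj (pqCocycle_trivialOn u) X (powA_mem j)]
  have h1 : (powB n hn m)⁻¹ * powA n hn j * powB n hn m = powA n hn (unitPow n (-m) * j) := by
    rw [← powB_conj_powA, ← powB_inv, inv_inv]
  have hc : powA n hn (unitPow n (-m) * j) ∈ Subgroup.centralizer {powA n hn l} := by
    rw [Subgroup.mem_centralizer_singleton_iff, powA_mul_powA, powA_mul_powA, add_comm]
  rw [h1]
  exact hX.character ⟨_, hc⟩

/-- Only the value of the character at the identity is used, so neither `u` nor `r` survives. -/
theorem trace_of_hasType_powB {u : ℕ} {k r : ZMod p} {Z : Center (VectG (pqCocycle n hn u))}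
    (hZ : HasType Z (powB n hn k) (charB n hn u k r)) {w : PQGroup n hn}
    (hw : IsConj (powB n hn k) w) : LinearMap.trace ℂ Z.1.carrier (Z.1.proj w) = 1 := by
  obtain ⟨d, rfl⟩ := isConj_iff.mp hw
  rw [trace_proj_conj (pqCocycle_trivialOn u)]
  have h := hZ.character 1
  rw [Subgroup.coe_one, centerAction_one, LinearMap.id_comp] at h
  rw [h]
  simp [charB, expZMod]

theorem borromeanTensor_of_hasType (hn1 : n ≠ 1) {u : ℕ} {l s : ZMod q} (hl : l ≠ 0)
    {k r : ZMod p} (hk : k ≠ 0) {X Y Z : Center (VectG (pqCocycle n hn u))}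
    (hX : HasType X (powA n hn l) (charA n hn l s))
    (hY : HasType Y (powA n hn l) (charA n hn l s))
    (hZ : HasType Z (powB n hn k) (charB n hn u k r)) :
    borromeanTensor X Y Z = ∑ i : ZMod p, ∑ m : ZMod p, ∑ _j : ZMod q,
      expZMod q (s * (unitPow n (-i) * (unitPow n m * l - unitPow n (m + k) * l)) +
        s * (unitPow n (-m) * (unitPow n i * l - unitPow n (i - k) * l))) := by
  have hproj {X : Center (VectG (pqCocycle n hn u))}
      (hX : HasType X (powA n hn l) (charA n hn l s)) (g : PQGroup n hn)
      (hg : g ∉ Set.range fun m : ZMod p => powA n hn (unitPow n m * l)) : X.1.proj g = 0 := by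
    by_contra h
    obtain ⟨m, rfl⟩ := (isConj_powA_iff l g).mp ((hX.support g).mp h)
    exact hg ⟨m, rfl⟩
  have hproj' {X : Center (VectG (pqCocycle n hn u))}
      (hX : HasType X (powA n hn l) (charA n hn l s)) (g : PQGroup n hn)
      (hg : g ∉ subgroupA n hn) : X.1.proj g = 0 := by
    apply hproj hX
    rintro ⟨m, rfl⟩
    exact hg (powA_mem _)
  have hprojZ (w : PQGroup n hn)
      (hw : w ∉ Set.range fun j => powA n hn j * powB n hn k) : Z.1.proj w = 0 := by
    by_contra h
    obtain ⟨m, rfl⟩ := (isConj_powB_iff hn1 hk w).mp ((hZ.support w).mp h)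
    exact hw ⟨m, rfl⟩
  have hinjA : Function.Injective fun m : ZMod p => powA n hn (unitPow n m * l) := by
    intro i j h
    have h1 := mul_right_cancel₀ hl (powA_injective h)
    exact unitPow_injective hn hn1 (Units.ext h1)
  have hinjB : Function.Injective fun j => powA n hn j * powB n hn k :=
    fun i j h => (powA_mul_powB_inj.mp h).1
  rw [borromeanTensor_eq_sum (pqCocycle_trivialOn u) subgroupA_comm X Y Z (hproj' hX) (hproj' hY)]
  -- The summand vanishes off the conjugacy classes, which are parametrized injectively by `m ↦
  -- a^(n^m l)` and `j ↦ a^j b^k`.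
  symm
  refine Fintype.sum_of_injective _ hinjA _ _ (fun g hg => by simp [hproj hX g hg]) fun i => ?_
  refine Fintype.sum_of_injective _ hinjA _ _ (fun g hg => by simp [hproj hY g hg]) fun m => ?_
  refine Fintype.sum_of_injective _ hinjB _ _ (fun g hg => by simp [hprojZ g hg]) fun j => ?_
  have e1 : powA n hn (unitPow n m * l) * (powA n hn j * powB n hn k) *
      (powA n hn (unitPow n m * l))⁻¹ * (powA n hn j * powB n hn k)⁻¹ =
      powA n hn (unitPow n m * l - unitPow n (m + k) * l) := by
    have := conj_powA (n := n) (hn := hn) j k (-(unitPow n m * l))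
    rw [powA_inv, mul_assoc, mul_assoc, ← mul_assoc (powA n hn j * powB n hn k), this,
      powA_mul_powA, unitPow_add hn, Units.val_mul]
    congr 1
    ring
  have e2 : (powA n hn j * powB n hn k)⁻¹ * (powA n hn (unitPow n i * l))⁻¹ *
      (powA n hn j * powB n hn k) * powA n hn (unitPow n i * l) =
      powA n hn (unitPow n i * l - unitPow n (i - k) * l) := by
    -- The exponent is chosen so that conjugation by `a^j b^k`, which multiplies it by `n^k`, yields
    -- the inverse of `a^(n^i l)`.
    have := conj_powA (n := n) (hn := hn) j k (-(unitPow n (i - k) * l))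
    rw [show (unitPow n k : ZMod q) * -(unitPow n (i - k) * l) = -(unitPow n i * l) by
      rw [mul_neg, ← mul_assoc, ← Units.val_mul, ← unitPow_add hn, add_sub_cancel]] at this
    rw [powA_inv, ← this, show ∀ a b : PQGroup n hn, a⁻¹ * (a * b * a⁻¹) * a = b by
      intros; group, powA_mul_powA]
    congr 1
    ring
  rw [e1, e2, trace_of_hasType_powA hX, trace_of_hasType_powA hY,
    trace_of_hasType_powB hZ ((isConj_powB_iff hn1 hk _).mpr ⟨j, rfl⟩), expZMod_add, mul_one]

theorem borromeanTensor_eq (hn1 : n ≠ 1) {u : ℕ} {l s : ZMod q} (hl : l ≠ 0)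
    {k r : ZMod p} (hk : k ≠ 0) {X Y Z : Center (VectG (pqCocycle n hn u))}
    (hX : HasType X (powA n hn l) (charA n hn l s))
    (hY : HasType Y (powA n hn l) (charA n hn l s))
    (hZ : HasType Z (powB n hn k) (charB n hn u k r)) {t : ℤ} (ht : ((2 * t : ℤ) : ZMod p) = k) :
    borromeanTensor X Y Z = (p : ℂ) * (q : ℂ) *
      ∑ m ∈ Finset.range p,
        expZMod q (s * l * (((n ^ (-t) : (ZMod q)ˣ) : ZMod q) - ((n ^ t : (ZMod q)ˣ) : ZMod q)) *
          (((n ^ m : (ZMod q)ˣ) : ZMod q) - (((n ^ m)⁻¹ : (ZMod q)ˣ) : ZMod q))) := by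
  let F : ZMod p → ℂ := fun d => expZMod q (s * l * (((unitPow n (-(t : ZMod p)) : (ZMod q)ˣ) :
    ZMod q) - unitPow n (t : ZMod p)) * (unitPow n d - unitPow n (-d)))
  have hF : ∑ m ∈ Finset.range p,
      expZMod q (s * l * (((n ^ (-t) : (ZMod q)ˣ) : ZMod q) - ((n ^ t : (ZMod q)ˣ) : ZMod q)) *
        (((n ^ m : (ZMod q)ˣ) : ZMod q) - (((n ^ m)⁻¹ : (ZMod q)ˣ) : ZMod q))) =
      ∑ d : ZMod p, F d := by
    refine Finset.sum_nbij' (fun m => (m : ZMod p)) ZMod.val (by simp)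
      (fun d _ => by simpa using d.val_lt) (fun m hm => ZMod.val_cast_of_lt (by simpa using hm))
      (fun d _ => by simp) fun m _ => ?_
    simp only [F]
    rw [unitPow_neg hn, unitPow_neg hn, unitPow_natCast hn, unitPow_intCast hn, zpow_neg]
  rw [hF, borromeanTensor_of_hasType hn1 hl hk hX hY hZ]
  -- With `k = 2t` and `d = m - i + t`, the four powers of `n` are `n^(d-t) - n^(d+t) + n^(t-d) -
  -- n^(-d-t)`, which factors as `(n^(-t) - n^t)(n^d - n^(-d))`.
  have hterm (i m : ZMod p) : ∑ _j : ZMod q,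
      expZMod q (s * (unitPow n (-i) * (unitPow n m * l - unitPow n (m + k) * l)) +
        s * (unitPow n (-m) * (unitPow n i * l - unitPow n (i - k) * l))) =
      q * F (m + (t - i)) := by
    rw [Finset.sum_const, Finset.card_univ, ZMod.card, nsmul_eq_mul]
    simp only [F]
    congr 2
    rw [← ht]
    push_cast
    simp only [sub_eq_add_neg, neg_add, neg_neg, two_mul, unitPow_add hn, unitPow_neg hn,
      Units.val_mul, Units.val_inv_eq_inv_val]
    have h1 := (unitPow n (t : ZMod p)).ne_zero
    have h2 := (unitPow n i).ne_zero
    have h3 := (unitPow n m).ne_zero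
    field_simp
    ring
  have hshift (i : ZMod p) : ∑ m : ZMod p, F (m + (t - i)) = ∑ d, F d :=
    Equiv.sum_comp (Equiv.addRight (t - i : ZMod p)) F
  simp only [hterm, ← Finset.mul_sum, hshift, Finset.sum_const, Finset.card_univ, ZMod.card,
    nsmul_eq_mul]
  ring

end PQGroup

/-! ### Half-braidings constructed from twisted actions -/

section OfAction

variable {G : Type} [Group G] [Fintype G] {ω : Cocycle3 G}

/-- A morphism of graded spaces with a linear inverse is an isomorphism. -/
def VectG.isoOfLinear {V W : VectG ω} (f : VectG.Hom V W) (f' : W.carrier →ₗ[ℂ] V.carrier)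
    (h : f' ∘ₗ f.lin = LinearMap.id) (h' : f.lin ∘ₗ f' = LinearMap.id) : V ≅ W where
  hom := f
  inv :=
    { lin := f'
      comm := fun g w => by
        have e (v : V.carrier) : f' (f.lin v) = v := LinearMap.congr_fun h v
        have e' (w : W.carrier) : f.lin (f' w) = w := LinearMap.congr_fun h' w
        rw [← e (V.proj g (f' w)), ← f.comm, e'] }
  hom_inv_id := VectG.hom_ext h
  inv_hom_id := VectG.hom_ext h'

variable {V : VectG ω} {A D : G → V.carrier →ₗ[ℂ] V.carrier}

/-- The linear map `x ⊗ u ↦ u ⊗ D c x` for `u` homogeneous of degree `c`. -/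
noncomputable def actionBraid (D : G → V.carrier →ₗ[ℂ] V.carrier) (U : VectG ω) :
    V.carrier ⊗[ℂ] U.carrier →ₗ[ℂ] U.carrier ⊗[ℂ] V.carrier :=
  ∑ c, (TensorProduct.comm ℂ V.carrier U.carrier).toLinearMap ∘ₗ
    TensorProduct.map (D c) (U.proj c)

/-- The linear map `u ⊗ x ↦ A c x ⊗ u` for `u` homogeneous of degree `c`. -/
noncomputable def actionBraidInv (A : G → V.carrier →ₗ[ℂ] V.carrier) (U : VectG ω) :
    U.carrier ⊗[ℂ] V.carrier →ₗ[ℂ] V.carrier ⊗[ℂ] U.carrier :=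
  ∑ c, (TensorProduct.comm ℂ U.carrier V.carrier).toLinearMap ∘ₗ
    TensorProduct.map (U.proj c) (A c)

theorem actionBraid_tmul {U : VectG ω} (x : V.carrier) {c : G} {u : U.carrier}
    (hu : U.IsHomog c u) : actionBraid D U (x ⊗ₜ u) = u ⊗ₜ D c x := by
  classical
  simp only [actionBraid, LinearMap.sum_apply, LinearMap.comp_apply, TensorProduct.map_tmul,
    hu.proj_eq, LinearEquiv.coe_coe, TensorProduct.comm_tmul]
  rw [Finset.sum_eq_single c]
  · simp
  all_goals simp +contextual

theorem actionBraidInv_tmul {U : VectG ω} (x : V.carrier) {c : G} {u : U.carrier}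
    (hu : U.IsHomog c u) : actionBraidInv A U (u ⊗ₜ x) = A c x ⊗ₜ u := by
  classical
  simp only [actionBraidInv, LinearMap.sum_apply, LinearMap.comp_apply, TensorProduct.map_tmul,
    hu.proj_eq, LinearEquiv.coe_coe, TensorProduct.comm_tmul]
  rw [Finset.sum_eq_single c]
  · simp
  all_goals simp +contextual

/-- The half-braiding defined by a twisted action `A`, with `D c` inverse to `A c`. -/
noncomputable def halfBraidingOfAction (V : VectG ω) (A D : G → V.carrier →ₗ[ℂ] V.carrier)
    (hAD : ∀ c, A c ∘ₗ D c = LinearMap.id) (hDA : ∀ c, D c ∘ₗ A c = LinearMap.id)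
    (hD : ∀ c g v, V.IsHomog g v → V.IsHomog (c⁻¹ * g * c) (D c v))
    (hmul : ∀ c d g v, V.IsHomog g v → D (c * d) v =
      (((ω.toFun c d ((c * d)⁻¹ * g * (c * d)))⁻¹ * ω.toFun c (c⁻¹ * g * c) d *
        (ω.toFun g c d)⁻¹ : ℂˣ) : ℂ) • D d (D c v)) :
    HalfBraiding V where
  β U := VectG.isoOfLinear (V := VectG.tensor V U) (W := VectG.tensor U V)
    { lin := actionBraid D U
      comm := VectG.comm_of_tmul (X := VectG.tensor U V) _ fun g v c u hv hu => by
        rw [actionBraid_tmul v hu]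
        have h := hu.tmul (hD c g v hv)
        rwa [mul_assoc, mul_inv_cancel_left] at h }
    (actionBraidInv A U)
    (by
      apply VectG.tensor_ext_homog
      intro g v c u hv hu
      rw [LinearMap.comp_apply, actionBraid_tmul v hu, actionBraidInv_tmul _ hu,
        ← LinearMap.comp_apply, hAD]
      rfl)
    (by
      apply VectG.tensor_ext_homog
      intro c u g v hu hv
      rw [LinearMap.comp_apply, actionBraidInv_tmul v hu, actionBraid_tmul _ hu,
        ← LinearMap.comp_apply, hDA]
      rfl)
  monoidal U U' := VectG.hom_ext (by
    apply VectG.tensor_ext_homog₃'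
    intro g v c u d u' hv hu hu'
    change actionBraid D (VectG.tensor U U') (v ⊗ₜ (u ⊗ₜ u')) =
      VectG.assocInvLin U U' V
        (TensorProduct.map LinearMap.id (actionBraid D U')
          (VectG.assocLin U V U'
            (TensorProduct.map (actionBraid D U) LinearMap.id
              (VectG.assocInvLin V U U' (v ⊗ₜ (u ⊗ₜ u'))))))
    have hv1 := hD c g v hv
    have hv2 := hD d _ _ hv1
    rw [actionBraid_tmul v (hu.tmul hu'), VectG.assocInvLin_tmul hv hu hu', map_smul, map_smul,
      map_smul, map_smul, TensorProduct.map_tmul, actionBraid_tmul v hu, LinearMap.id_apply,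
      VectG.assocLin_tmul hu hv1 hu', map_smul, map_smul, TensorProduct.map_tmul,
      actionBraid_tmul _ hu', LinearMap.id_apply, VectG.assocInvLin_tmul hu hu' hv2,
      hmul c d g v hv, TensorProduct.tmul_smul, smul_smul, smul_smul, ← Units.val_mul,
      ← Units.val_mul]
    congr 2
    rw [show d⁻¹ * (c⁻¹ * g * c) * d = (c * d)⁻¹ * g * (c * d) by group]
    ac_rfl)
  naturality {U U'} f := VectG.hom_ext (by
    apply VectG.tensor_ext_homog
    intro g v c u hv hu
    change actionBraid D U' (v ⊗ₜ f.lin u) =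
      TensorProduct.map f.lin LinearMap.id (actionBraid D U (v ⊗ₜ u))
    rw [actionBraid_tmul v hu, actionBraid_tmul v (VectG.Hom.isHomog f hu)]
    rfl)

theorem centerAction_of_inv_lin {b : HalfBraiding V} {A : G → V.carrier →ₗ[ℂ] V.carrier}
    (hb : ∀ U, (b.β U).inv.lin = actionBraidInv A U) (c : G) :
    centerAction (⟨V, b⟩ : Center (VectG ω)) c = A c := by
  ext v
  have h : centerAction (⟨V, b⟩ : Center (VectG ω)) c v = TensorProduct.rid ℂ V.carrier
      (actionBraidInv A (VectG.delta ω c) ((1 : ℂ) ⊗ₜ v)) := by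
    rw [← hb]
    rfl
  rw [h, actionBraidInv_tmul v (VectG.delta_isHomog c 1)]
  simp

end OfAction

/-! ### Monomial objects on a conjugacy class -/

section ClassFunctions

variable {G : Type} [Group G]

open scoped Classical in
/-- The projection of functions on the conjugacy class of `g` onto those supported at `c`. -/
noncomputable def classProj (g c : G) : ({x // IsConj g x} → ℂ) →ₗ[ℂ] ({x // IsConj g x} → ℂ) :=
  LinearMap.pi fun x => (if (x : G) = c then (1 : ℂ) else 0) • LinearMap.proj x

theorem classProj_apply_of_eq {g c : G} {x : {x // IsConj g x}} (h : (x : G) = c)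
    (f : {x // IsConj g x} → ℂ) : classProj g c f x = f x := by
  simp [classProj, h]

theorem classProj_apply_of_ne {g c : G} {x : {x // IsConj g x}} (h : (x : G) ≠ c)
    (f : {x // IsConj g x} → ℂ) : classProj g c f x = 0 := by
  simp [classProj, h]

/-- Conjugation by `c` on the conjugacy class of `g`. -/
def classConj {g : G} (c : G) (x : {x // IsConj g x}) : {x // IsConj g x} :=
  ⟨c * x * c⁻¹, x.2.trans (isConj_iff.mpr ⟨c, rfl⟩)⟩

theorem classConj_inv_classConj {g : G} (c : G) (x : {x // IsConj g x}) :
    classConj c⁻¹ (classConj c x) = x := Subtype.ext (by simp [classConj, mul_assoc])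

theorem classConj_classConj_inv {g : G} (c : G) (x : {x // IsConj g x}) :
    classConj c (classConj c⁻¹ x) = x := Subtype.ext (by simp [classConj, mul_assoc])

theorem classConj_classConj {g : G} (c d : G) (x : {x // IsConj g x}) :
    classConj c (classConj d x) = classConj (c * d) x :=
  Subtype.ext (by simp [classConj, mul_assoc])

/-- The twisted action that maps the delta function at `x` to `(θ c x)⁻¹` times that at
`c * x * c⁻¹`. -/
noncomputable def classAction (θ : G → G → ℂˣ) (g c : G) :
    ({x // IsConj g x} → ℂ) →ₗ[ℂ] ({x // IsConj g x} → ℂ) :=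
  LinearMap.pi fun x => (((θ c (classConj c⁻¹ x))⁻¹ : ℂˣ) : ℂ) • LinearMap.proj (classConj c⁻¹ x)

/-- The inverse of `classAction`. -/
noncomputable def classActionInv (θ : G → G → ℂˣ) (g c : G) :
    ({x // IsConj g x} → ℂ) →ₗ[ℂ] ({x // IsConj g x} → ℂ) :=
  LinearMap.pi fun x => ((θ c x : ℂˣ) : ℂ) • LinearMap.proj (classConj c x)

theorem classAction_apply (θ : G → G → ℂˣ) (g c : G) (f : {x // IsConj g x} → ℂ)
    (x : {x // IsConj g x}) : classAction θ g c f x =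
      (((θ c (classConj c⁻¹ x))⁻¹ : ℂˣ) : ℂ) * f (classConj c⁻¹ x) := rfl

theorem classActionInv_apply (θ : G → G → ℂˣ) (g c : G) (f : {x // IsConj g x} → ℂ)
    (x : {x // IsConj g x}) : classActionInv θ g c f x = (θ c x : ℂ) * f (classConj c x) := rfl

theorem classAction_comp_inv (θ : G → G → ℂˣ) (g c : G) :
    classAction θ g c ∘ₗ classActionInv θ g c = LinearMap.id := by
  refine LinearMap.ext fun f => funext fun x => ?_
  rw [LinearMap.comp_apply, classAction_apply, classActionInv_apply, classConj_classConj_inv,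
    ← mul_assoc, Units.inv_mul, one_mul, LinearMap.id_apply]

theorem classActionInv_comp (θ : G → G → ℂˣ) (g c : G) :
    classActionInv θ g c ∘ₗ classAction θ g c = LinearMap.id := by
  refine LinearMap.ext fun f => funext fun x => ?_
  rw [LinearMap.comp_apply, classActionInv_apply, classAction_apply, classConj_inv_classConj,
    ← mul_assoc, Units.mul_inv, one_mul, LinearMap.id_apply]

/-- Since `c` commutes with `g`, the operator has rank one: it sends `f` to `(θ c g)⁻¹ * f g` times
the delta function at `g`. -/
theorem trace_classAction_comp_classProj [Finite G] (θ : G → G → ℂˣ) {g c : G}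
    (hc : c * g = g * c) :
    LinearMap.trace ℂ ({x // IsConj g x} → ℂ) (classAction θ g c ∘ₗ classProj g g) =
      (((θ c g)⁻¹ : ℂˣ) : ℂ) := by
  classical
  have h : classAction θ g c ∘ₗ classProj g g =
      (LinearMap.proj (⟨g, IsConj.refl g⟩ : {x // IsConj g x}) :
        ({x // IsConj g x} → ℂ) →ₗ[ℂ] ℂ).smulRight
        ((((θ c g)⁻¹ : ℂˣ) : ℂ) • Pi.single ⟨g, IsConj.refl g⟩ (1 : ℂ)) := by
    refine LinearMap.ext fun f => funext fun x => ?_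
    rw [LinearMap.comp_apply, classAction_apply]
    by_cases hx : x = ⟨g, IsConj.refl g⟩
    · subst hx
      have e : classConj c⁻¹ (⟨g, IsConj.refl g⟩ : {x // IsConj g x}) = ⟨g, IsConj.refl g⟩ :=
        Subtype.ext (by simp [classConj, mul_assoc, ← hc])
      rw [e, classProj_apply_of_eq (c := g) (x := ⟨g, IsConj.refl g⟩) rfl]
      simp [mul_comm]
    · rw [classProj_apply_of_ne]
      · simp [hx]
      · intro e
        apply hx
        rw [← classConj_classConj_inv c x]
        apply Subtype.ext
        simp [classConj] at e
        simp [classConj, e, hc]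
  rw [h, LinearMap.trace_smulRight]
  simp

/-- Functions on the conjugacy class of `g`, with the delta function at `x` in degree `x`. -/
noncomputable abbrev classFunctions [Fintype G] (ω : Cocycle3 G) (g : G) : VectG ω where
  carrier := {x // IsConj g x} → ℂ
  proj c := classProj g c
  proj_self c f := by
    ext x
    by_cases h : (x : G) = c
    · rw [classProj_apply_of_eq h]
    · rw [classProj_apply_of_ne h, classProj_apply_of_ne h]
  proj_ne c d f hcd := by
    ext x
    by_cases h : (x : G) = c
    · rw [classProj_apply_of_eq h, classProj_apply_of_ne (h ▸ hcd), Pi.zero_apply]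
    · rw [classProj_apply_of_ne h, Pi.zero_apply]
  sum_proj f := by
    ext x
    rw [Finset.sum_apply, Finset.sum_eq_single (x : G)]
    · rw [classProj_apply_of_eq rfl]
    · exact fun c _ hc => classProj_apply_of_ne hc.symm f
    · simp

variable [Fintype G] {ω : Cocycle3 G}

theorem classFunctions_isHomog_iff {g c : G} {f : {x // IsConj g x} → ℂ} :
    (classFunctions ω g).IsHomog c f ↔ ∀ x : {x // IsConj g x}, (x : G) ≠ c → f x = 0 := by
  constructor
  · intro h x hx
    rw [← show classProj g c f = f from h, classProj_apply_of_ne hx]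
  · intro h
    refine funext fun x => ?_
    by_cases hx : (x : G) = c
    · exact classProj_apply_of_eq hx f
    · rw [h x hx]
      exact classProj_apply_of_ne hx f

/-- `θ` is a multiplier for the conjugation action of `G` on the conjugacy class of `g`,
twisted by `ω`. -/
def IsClassMultiplier (ω : Cocycle3 G) (g : G) (θ : G → G → ℂˣ) : Prop :=
  ∀ c d x, IsConj g x → θ (c * d) x * ω.toFun c d x * ω.toFun (c * d * x * (c * d)⁻¹) c d =
    ω.toFun c (d * x * d⁻¹) d * θ d x * θ c (d * x * d⁻¹)

theorem classActionInv_isHomog (θ : G → G → ℂˣ) (g c h : G) (f : {x // IsConj g x} → ℂ)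
    (hf : (classFunctions ω g).IsHomog h f) :
    (classFunctions ω g).IsHomog (c⁻¹ * h * c) (classActionInv θ g c f) := by
  rw [classFunctions_isHomog_iff] at hf ⊢
  intro x hx
  rw [classActionInv_apply, hf, mul_zero]
  rintro rfl
  exact hx (by simp [classConj, mul_assoc])

/-- At a point `x` with `(c d) x (c d)⁻¹ = h` this is the multiplier identity, rearranged; at all
other points both sides vanish. -/
theorem classActionInv_mul {g : G} {θ : G → G → ℂˣ} (hθ : IsClassMultiplier ω g θ) (c d h : G)
    (f : {x // IsConj g x} → ℂ) (hf : (classFunctions ω g).IsHomog h f) :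
    classActionInv θ g (c * d) f =
      (((ω.toFun c d ((c * d)⁻¹ * h * (c * d)))⁻¹ * ω.toFun c (c⁻¹ * h * c) d *
        (ω.toFun h c d)⁻¹ : ℂˣ) : ℂ) • classActionInv θ g d (classActionInv θ g c f) := by
  rw [classFunctions_isHomog_iff] at hf
  funext x
  rw [Pi.smul_apply, classActionInv_apply, classActionInv_apply, classActionInv_apply,
    classConj_classConj, smul_eq_mul]
  by_cases h1 : (classConj (c * d) x : G) = h
  · subst h1
    rw [← mul_assoc, ← mul_assoc, ← Units.val_mul, ← Units.val_mul]
    congr 2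
    have e0 : (classConj (c * d) x : G) = c * d * x * (c * d)⁻¹ := rfl
    have e1 : (c * d)⁻¹ * (classConj (c * d) x : G) * (c * d) = x := by
      simp [classConj, mul_assoc]
    have e2 : c⁻¹ * (classConj (c * d) x : G) * c = d * x * d⁻¹ := by
      simp [classConj, mul_assoc]
    rw [e1, e2, e0, show (classConj d x : G) = d * x * d⁻¹ from rfl, eq_comm, mul_assoc,
      mul_right_comm _ _ (θ d x * _), mul_inv_eq_iff_eq_mul, mul_assoc, inv_mul_eq_iff_eq_mul,
      ← mul_assoc, ← hθ c d x x.2]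
    ac_rfl
  · rw [hf _ h1]
    simp

/-- The object of the center on `classFunctions ω g` defined by a class multiplier. -/
noncomputable def classCenter {g : G} {θ : G → G → ℂˣ} (hθ : IsClassMultiplier ω g θ) :
    Center (VectG ω) :=
  ⟨classFunctions ω g, halfBraidingOfAction (classFunctions ω g) (classAction θ g)
    (classActionInv θ g) (classAction_comp_inv θ g) (classActionInv_comp θ g)
    (classActionInv_isHomog θ g) (classActionInv_mul hθ)⟩

theorem hasType_classCenter {g : G} {θ : G → G → ℂˣ} (hθ : IsClassMultiplier ω g θ)
    {χ : Subgroup.centralizer {g} → ℂ} (hχ : ∀ c, χ c = (((θ c g)⁻¹ : ℂˣ) : ℂ)) :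
    HasType (classCenter hθ) g χ where
  support x := by
    change classProj g x ≠ 0 ↔ _
    constructor
    · intro h
      by_contra hx
      exact h (LinearMap.ext fun f => funext fun y =>
        classProj_apply_of_ne (by rintro rfl; exact hx y.2) f)
    · intro hx h
      have h1 : classProj g x (fun _ => (1 : ℂ)) ⟨x, hx⟩ = 0 := by
        rw [h]
        rfl
      rw [classProj_apply_of_eq (c := x) (x := ⟨x, hx⟩) rfl] at h1
      exact one_ne_zero h1
  character c := by
    have h (d : G) : centerAction (classCenter hθ) d = classAction θ g d :=
      centerAction_of_inv_lin (V := classFunctions ω g) (b := (classCenter hθ).2)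
        (A := classAction θ g) (fun _ => rfl) d
    rw [h, hχ, ← trace_classAction_comp_classProj θ
      (Subgroup.mem_centralizer_singleton_iff.mp c.2)]
    rfl

end ClassFunctions

/-! ### Objects of types `(a^l, χ_q^s)` and `(b^k, χ_p^r)` -/

section Existence

variable {p q : ℕ} [Fact p.Prime] {n : (ZMod q)ˣ} {hn : n ^ p = 1}

theorem expZMod_ne_zero (N : ℕ) (x : ZMod N) : expZMod N x ≠ 0 := Complex.exp_ne_zero _

/-- The multiplier on the class of `b ^ k` that defines an object of type `(b ^ k, χ_p ^ r)`. -/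
noncomputable def multiplierB (n : (ZMod q)ˣ) (hn : n ^ p = 1) (u : ℕ) (k r : ZMod p)
    (c _x : PQGroup n hn) : ℂˣ :=
  Units.mk0 (expZMod p (-(r * c.right.toAdd)) *
    Complex.exp (2 * Real.pi * Complex.I / (p : ℂ) ^ 2 *
      ((u : ℂ) * (k.val : ℂ) * (c.right.toAdd.val : ℂ))))
    (mul_ne_zero (expZMod_ne_zero _ _) (Complex.exp_ne_zero _))

variable [Fact q.Prime]

theorem expZMod_neg (N : ℕ) [Fact N.Prime] (x : ZMod N) : expZMod N (-x) = (expZMod N x)⁻¹ := by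
  apply eq_inv_of_mul_eq_one_left
  rw [← expZMod_add, neg_add_cancel]
  simp [expZMod]

/-- The multiplier on the class of `a ^ l` that defines an object of type `(a ^ l, χ_q ^ s)`. -/
noncomputable def multiplierA (n : (ZMod q)ˣ) (hn : n ^ p = 1) (l s : ZMod q)
    (c x : PQGroup n hn) : ℂˣ :=
  Units.mk0 (expZMod q (-(s * l * c.left.toAdd / (unitPow n c.right.toAdd * x.left.toAdd))))
    (expZMod_ne_zero _ _)

/-- The cocycle is trivial here, so an honest action is needed: `b` permutes the delta functions
without scalars, and `a^i` acts on the one at `a^y` by `exp (2πi s l i / (q y))`, with `l / y` taken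
in `ℤ/q`. In the multiplier, `y` is the exponent after conjugation by `c`, which explains the
denominator. -/
theorem isClassMultiplier_multiplierA (u : ℕ) (l s : ZMod q) :
    IsClassMultiplier (pqCocycle n hn u) (powA n hn l) (multiplierA n hn l s) := by
  have key (i j y : ZMod q) (m m' : ZMod p) :
      multiplierA n hn l s (powA n hn i * powB n hn m * (powA n hn j * powB n hn m'))
        (powA n hn y) =
      multiplierA n hn l s (powA n hn j * powB n hn m') (powA n hn y) *
        multiplierA n hn l s (powA n hn i * powB n hn m) (powA n hn (unitPow n m' * y)) := by
    have e : powA n hn i * powB n hn m * (powA n hn j * powB n hn m') =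
        powA n hn (i + unitPow n m * j) * powB n hn (m + m') := by
      rw [mul_assoc, ← mul_assoc (powB n hn m), powB_mul_powA, mul_assoc, powB_mul_powB,
        ← mul_assoc, powA_mul_powA]
    have el (i : ZMod q) (m : ZMod p) : (powA n hn i * powB n hn m).left.toAdd = i := by
      simp [powA, powB]
    have er (i : ZMod q) (m : ZMod p) : (powA n hn i * powB n hn m).right.toAdd = m := by
      simp [powA, powB]
    have ea (i : ZMod q) : (powA n hn i).left.toAdd = i := by
      simp [powA]
    rw [e]
    apply Units.ext
    simp only [multiplierA, Units.val_mk0, Units.val_mul, el, er, ea]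
    rw [← expZMod_add, unitPow_add hn, Units.val_mul]
    congr 1
    have h1 := (unitPow n m).ne_zero
    have h2 := (unitPow n m').ne_zero
    -- For `y = 0` division by zero gives `0`, and all exponents vanish.
    by_cases hy : y = 0
    · simp [hy]
    · field_simp
      ring
  intro c d x hx
  obtain ⟨m, rfl⟩ := (isConj_powA_iff l x).mp hx
  have hN := pqCocycle_trivialOn (n := n) (hn := hn) u
  have hmem := powA_mem (n := n) (hn := hn) (unitPow n m * l)
  have hmem' := Subgroup.Normal.conj_mem inferInstance _ hmem (c * d)
  have hmem'' := Subgroup.Normal.conj_mem inferInstance _ hmem d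
  rw [hN c d _ (by tauto), hN _ c d (by tauto), hN c _ d (by tauto), mul_one, mul_one, one_mul,
    eq_powA_mul_powB c, eq_powA_mul_powB d, key, conj_powA]

theorem exists_hasType_powA (u : ℕ) {l : ZMod q} (hl : l ≠ 0) (s : ZMod q) :
    ∃ X : Center (VectG (pqCocycle n hn u)), HasType X (powA n hn l) (charA n hn l s) := by
  refine ⟨_, hasType_classCenter (isClassMultiplier_multiplierA u l s) fun c => ?_⟩
  have hc : (c : PQGroup n hn) * powA n hn l * (c : PQGroup n hn)⁻¹ = powA n hn l := by
    rw [Subgroup.mem_centralizer_singleton_iff.mp c.2, mul_inv_cancel_right]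
  have h1 := conj_powA (n := n) (hn := hn) (c : PQGroup n hn).left.toAdd
    (c : PQGroup n hn).right.toAdd l
  rw [← eq_powA_mul_powB, hc] at h1
  -- As `c` centralizes `a^l`, the denominator in the multiplier is `l` itself and cancels.
  have h2 : ((unitPow n (c : PQGroup n hn).right.toAdd : (ZMod q)ˣ) : ZMod q) * l = l :=
    (powA_injective h1).symm
  rw [charA, multiplierA, Units.val_inv_eq_inv_val, Units.val_mk0, expZMod_neg, inv_inv,
    show (powA n hn l).left.toAdd = l from rfl, h2]
  congr 1
  field_simp

/-- All conjugates of `b^k` have the same image in `⟨b⟩`. As `ω(i, j, k)` is symmetric in `j` and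
`k`, two of the three cocycle values cancel. The third involves `[k]([m] + [m'] - [m + m'])`,
exactly the failure of `m ↦ [k][m]` to be additive, which the second factor of `multiplierB`
compensates. -/
theorem isClassMultiplier_multiplierB (hn1 : n ≠ 1) (u : ℕ) {k : ZMod p} (hk : k ≠ 0)
    (r : ZMod p) :
    IsClassMultiplier (pqCocycle n hn u) (powB n hn k) (multiplierB n hn u k r) := by
  intro c d x hx
  have er : x.right.toAdd = k := by
    obtain ⟨j, rfl⟩ := (isConj_powB_iff hn1 hk x).mp hx
    simp [powA, powB]
  have er' (c : PQGroup n hn) : (c * x * c⁻¹).right.toAdd = k := by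
    simp [er]
  apply Units.ext
  simp only [multiplierB, pqCocycle, Cocycle3.power, Cocycle3.inflate, cyclicCocycle,
    SemidirectProduct.rightHom_eq_right, Units.val_mul, Units.val_pow_eq_pow_val, Units.val_mk0,
    er, er', toAdd_mul, ← Complex.exp_nat_mul]
  simp only [SemidirectProduct.mul_right, toAdd_mul, mul_add, neg_add, expZMod_add]
  generalize c.right.toAdd = m
  generalize d.right.toAdd = m'
  -- This makes the two cocycle values related by the symmetry literally equal.
  rw [add_comm k m']
  rw [show ∀ a b e f g : ℂ, a * b * e * f * g = (a * b) * (e * f * g) by intros; ring,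
    show ∀ a b e f g : ℂ, a * (b * e) * (f * g) = (f * b) * (a * e * g) by intros; ring,
    ← Complex.exp_add, ← Complex.exp_add, ← Complex.exp_add, ← Complex.exp_add]
  congr 2
  ring

theorem exists_hasType_powB (hn1 : n ≠ 1) (u : ℕ) {k : ZMod p} (hk : k ≠ 0) (r : ZMod p) :
    ∃ Z : Center (VectG (pqCocycle n hn u)), HasType Z (powB n hn k) (charB n hn u k r) := by
  refine ⟨_, hasType_classCenter (isClassMultiplier_multiplierB hn1 u hk r) fun c => ?_⟩
  rw [charB, multiplierB, Units.val_inv_eq_inv_val, Units.val_mk0, mul_inv, expZMod_neg, inv_inv,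
    Complex.exp_neg]

end Existence

theorem mainTheorem2 (p q : ℕ) [Fact p.Prime] [Fact q.Prime] (hp : Odd p) (hq : Odd q)
    (hpq : p ∣ q - 1) (n : (ZMod q)ˣ) (hn : n ^ p = 1) (hn1 : n ≠ 1) (u : ℕ) (hu : u < p)
    (l s : ZMod q) (hl : l ≠ 0) (k r : ZMod p) (hk : k ≠ 0) :
    (∃ X : Center (VectG (pqCocycle n hn u)), HasType X (powA n hn l) (charA n hn l s)) ∧
    (∃ Z : Center (VectG (pqCocycle n hn u)), HasType Z (powB n hn k) (charB n hn u k r)) ∧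
    ∀ X Y Z : Center (VectG (pqCocycle n hn u)),
      HasType X (powA n hn l) (charA n hn l s) →
      HasType Y (powA n hn l) (charA n hn l s) →
      HasType Z (powB n hn k) (charB n hn u k r) →
      ∀ t : ℤ, ((2 * t : ℤ) : ZMod p) = k →
        borromeanTensor X Y Z = (p : ℂ) * (q : ℂ) *
          ∑ m ∈ Finset.range p,
            expZMod q (s * l * (((n ^ (-t) : (ZMod q)ˣ) : ZMod q) - ((n ^ t : (ZMod q)ˣ) : ZMod q)) *
              (((n ^ m : (ZMod q)ˣ) : ZMod q) - (((n ^ m)⁻¹ : (ZMod q)ˣ) : ZMod q))) := by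
  exact ⟨exists_hasType_powA u hl s, exists_hasType_powB hn1 u hk r,
    fun _ _ _ hX hY hZ _ ht => borromeanTensor_eq hn1 hl hk hX hY hZ ht⟩
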